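/- **Setting.** An un-discounted non-stationary MDP with $S$ states, $A$ actions and horizon $T$ consists of an initial state $s_1$ and, for each time $t=1,\dots,T$, a transition kernel $P_t(\cdot\mid s,a)$ and random rewards in $[0,1]$ with mean $r_t(s,a)$. A learning algorithm chooses $a_t$, possibly at random, from the history of states, actions and rewards before time $t$ and the current state $s_t$; it may depend on $S,A,T,\Delta,D$. Let $\rho_t^\star$ be the optimal long-term average reward of the stationary MDP $(P_t,r_t)$. The (expected) dynamic regret of the algorithm is $$\mathcal R(T)=\sum_{t=1}^{T}\bigl(\rho_t^\star-\mathbb E[r_t(s_t,a_t)]\bigr).$$ The total variation of the MDP is $$\sum_{t=1}^{T-1}\max_{s,a}|r_t(s,a)-r_{t+1}(s,a)|+\sum_{t=1}^{T-1}\max_{s,a}\|P_t(\cdot\mid s,a)-P_{t+1}(\cdot\mid s,a)\|_1 ,$$ and its maximum diameter is the maximum over $t\le T$ of the diameter $\max_{s\ne s'}\min_{\pi}\mathbb E[\text{time to reach } s' \text{ from } s \text{ under } \pi \text{ in } P_t]$, where $\pi$ ranges over stationary policies. **Proposition.** There are universal constants $c,C>0$ such that the following holds for all integers $S,A\ge 2$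 and $T$ and all reals $\Delta>0$ and $D\ge C(1+\log_A S)$ with $T\ge SAD$ and $T\ge SA\Delta D^2$. For every learning algorithm there is an un-discounted non-stationary MDP with $S$ states and $A$ actions, of total variation at most $\Delta$ and maximum diameter at most $D$, on which the dynamic regret of the algorithm over the horizon $T$ is at least $$c\,S^{1/3}A^{1/3}\Delta^{1/3}D^{2/3}T^{2/3}.$$ -/

import Mathlib

open scoped ENNReal

namespace UndiscountedRL

noncomputable section

/-- A (stationary) transition kernel on states `S` with actions `A`. -/
abbrev TransitionKernel (S A : Type) := S → A → PMF S

/-- An un-discounted non-stationary MDP with finite state and action spaces. At time `t`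
(times are `0, 1, 2, …`), taking action `a` in state `s` yields a random reward in `[0, 1]`
with law `rewardLaw t s a`, and the next state has law `trans t s a`. Only the data at
times `t < T` matter when the horizon is `T`. -/
structure NonstationaryMDP (S A : Type) where
  /-- the initial state -/
  init : S
  /-- the transition kernel of each time step -/
  trans : ℕ → TransitionKernel S A
  /-- the law of the random reward of each time step -/
  rewardLaw : ℕ → S → A → PMF ℝ
  /-- rewards lie in `[0, 1]` -/
  reward_mem : ∀ t s a, ∀ x ∈ (rewardLaw t s a).support, x ∈ Set.Icc (0 : ℝ) 1

/-- What the learner has seen before the current state: the list, in order of time, of the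
visited states, the actions taken there and the rewards received. -/
abbrev History (S A : Type) := List (S × A × ℝ)

/-- A learning algorithm: it (possibly randomly) chooses the next action from the whole
history of states, actions and rewards and from the current state. -/
abbrev Algorithm (S A : Type) := History S A → S → PMF A

section Stationary

variable {S A : Type} [Fintype S]

/-- The expected total reward of the first `n` steps of the stationary policy `π`, started in
`s`, in the stationary MDP with transitions `P` and mean rewards `r`. -/
def totalReward (P : TransitionKernel S A) (r : S → A → ℝ) (π : S → A) : ℕ → S → ℝ
  | 0, _ => 0
  | n + 1, s => r s (π s) + ∑ y, (P s (π s) y).toReal * totalReward P r π n y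

/-- The long-term average reward of the stationary policy `π` started in `s`. (On a finite
state space the averages converge, so the lower limit is the limit.) -/
def averageReward (P : TransitionKernel S A) (r : S → A → ℝ) (π : S → A) (s : S) : ℝ :=
  Filter.liminf (fun n : ℕ => totalReward P r π n s / n) Filter.atTop

/-- The optimal long-term average reward `ρ*` of the stationary MDP `(P, r)`. When the
diameter is finite, the optimal average reward from every initial state is the same, so the
maximum over initial states is the common value. -/
def optimalAverageReward (P : TransitionKernel S A) (r : S → A → ℝ) : ℝ :=
  ⨆ π : S → A, ⨆ s : S, averageReward P r π s

open Classical in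
/-- The probability that the stationary policy `π`, started in `s`, visits `goal` at none of
the times `0, …, n`. -/
def avoidProb (P : TransitionKernel S A) (π : S → A) (goal : S) : ℕ → S → ℝ≥0∞
  | 0, s => if s = goal then 0 else 1
  | n + 1, s => if s = goal then 0 else ∑ y, P s (π s) y * avoidProb P π goal n y

/-- The expected first time at which the stationary policy `π`, started in `s`, visits
`goal`: the sum over `n` of the probabilities that this time exceeds `n`. -/
def expectedHittingTime (P : TransitionKernel S A) (π : S → A) (goal s : S) : ℝ≥0∞ :=
  ∑' n, avoidProb P π goal n s

/-- The diameter of an MDP: the largest, over pairs of distinct states `s, s'`, of the least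
expected time in which a stationary policy gets from `s` to `s'`. -/
def diameter (P : TransitionKernel S A) : ℝ≥0∞ :=
  ⨆ (s : S) (s' : S) (_ : s ≠ s'), ⨅ π : S → A, expectedHittingTime P π s' s

end Stationary

namespace NonstationaryMDP

variable {S A : Type}

/-- The mean reward `r_t(s, a)`. -/
def meanReward (M : NonstationaryMDP S A) (t : ℕ) (s : S) (a : A) : ℝ :=
  ∫ x, x ∂(M.rewardLaw t s a).toMeasure

/-- The joint law of the history before time `t` and the state `s_t` when `alg` interacts
with `M`. -/
def runLaw (M : NonstationaryMDP S A) (alg : Algorithm S A) : ℕ → PMF (History S A × S)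
  | 0 => PMF.pure ([], M.init)
  | t + 1 =>
    (runLaw M alg t).bind fun hs =>
      (alg hs.1 hs.2).bind fun a =>
        (M.rewardLaw t hs.2 a).bind fun x =>
          (M.trans t hs.2 a).map fun s' => (hs.1 ++ [(hs.2, a, x)], s')

/-- The joint law of the state `s_t` and the action `a_t` when `alg` interacts with `M`. -/
def stateActionLaw (M : NonstationaryMDP S A) (alg : Algorithm S A) (t : ℕ) : PMF (S × A) :=
  (M.runLaw alg t).bind fun hs => (alg hs.1 hs.2).map fun a => (hs.2, a)

variable [Fintype S] [Fintype A]

/-- The expected reward `𝔼[r_t(s_t, a_t)]` of `alg` at time `t`. -/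
def expectedReward (M : NonstationaryMDP S A) (alg : Algorithm S A) (t : ℕ) : ℝ :=
  ∑ p : S × A, (M.stateActionLaw alg t p).toReal * M.meanReward t p.1 p.2

/-- The (expected) dynamic regret over the horizon `T`: at each time the benchmark is the
optimal average reward of the MDP of that time. -/
def dynamicRegret (M : NonstationaryMDP S A) (alg : Algorithm S A) (T : ℕ) : ℝ :=
  ∑ t ∈ Finset.range T,
    (optimalAverageReward (M.trans t) (M.meanReward t) - M.expectedReward alg t)

/-- Total variation of the mean rewards over the horizon `T`. -/
def rewardVariation (M : NonstationaryMDP S A) (T : ℕ) : ℝ :=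
  ∑ t ∈ Finset.range (T - 1),
    ⨆ p : S × A, |M.meanReward t p.1 p.2 - M.meanReward (t + 1) p.1 p.2|

/-- Total variation, in the `L¹` norm, of the transition kernels over the horizon `T`. -/
def transitionVariation (M : NonstationaryMDP S A) (T : ℕ) : ℝ :=
  ∑ t ∈ Finset.range (T - 1),
    ⨆ p : S × A, ∑ s', |(M.trans t p.1 p.2 s').toReal - (M.trans (t + 1) p.1 p.2 s').toReal|

/-- The total variation of the MDP over the horizon `T`. -/
def totalVariation (M : NonstationaryMDP S A) (T : ℕ) : ℝ :=
  M.rewardVariation T + M.transitionVariation T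

/-- The maximum diameter of the MDPs of the times `t < T`. -/
def maxDiameter (M : NonstationaryMDP S A) (T : ℕ) : ℝ≥0∞ :=
  ⨆ t ∈ Finset.range T, diameter (M.trans t)

end NonstationaryMDP

end

end UndiscountedRL

/-! The hard MDP has a good state (reward 1) and a tree of inner states (reward 1/2) whose leaves
have reward 0. One falls from the good state to the root at rate `δ`, of order `1/D`, and returns
from a leaf at rate `δ`, except that one special leaf-action pair returns at rate `δ + ε`. Without
the special pair the flow between good state and leaves balances, so the mean reward is about 1/2
whatever the algorithm does. A policy that always uses the special pair gains an extra amount of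
order `ε/δ` per step (`Navigable.le_optimalAverageReward`), and an algorithm gains only in
proportion to its uses of that pair (`sum_expectedReward_le`).

The special pair changes only between blocks of length `τ`. With no special pair on a block, some
one of the `n` leaf-action pairs, `n` of order `S * A`, is used at most about `τ/(2n)` times in
expectation (`exists_sum_occ_le`). Making it special multiplies this count by at most a constant
plus `20 ε² τ / δ` (`futureVisits_log_le`, `sum_occ_special_le`). The bound is purely multiplicative
because information is paid for only at visits to the pair. So if `ε² τ / δ` is a small multiple of
`n`, the special pair is used on at most 7/20 of all steps, and the regret is of order `T ε / δ`.

The variation is about `ε T / τ`. Taking `τ` of order `n δ / ε²` and spending the budget `Δ` gives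
`ε` of order `(S A Δ / (D T))^(1/3)`, hence the rate. The tree has logarithmic depth, so the
diameter is dominated by `2/δ`. -/

namespace UndiscountedRL

noncomputable section

/-! ### Means with values in `[0, ∞]`, where sums over histories need no summability. -/

section Mean

variable {α β : Type*}

/-- The mean of an extended nonnegative function under a probability mass function. -/
def mean (μ : PMF α) (f : α → ℝ≥0∞) : ℝ≥0∞ := ∑' a, μ a * f a

theorem mean_pure (a : α) (f : α → ℝ≥0∞) : mean (PMF.pure a) f = f a := by
  classical
  rw [mean, tsum_eq_single a]
  · simp
  · intro b hb
    simp [hb]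

theorem mean_bind (μ : PMF α) (κ : α → PMF β) (f : β → ℝ≥0∞) :
    mean (μ.bind κ) f = mean μ fun a => mean (κ a) f := by
  simp only [mean, PMF.bind_apply, ← ENNReal.tsum_mul_right, ← ENNReal.tsum_mul_left]
  rw [ENNReal.tsum_comm]
  simp only [mul_assoc]

theorem mean_map (μ : PMF α) (g : α → β) (f : β → ℝ≥0∞) :
    mean (μ.map g) f = mean μ fun a => f (g a) := by
  rw [← PMF.bind_pure_comp, mean_bind]
  simp only [Function.comp, mean_pure]

theorem mean_add (μ : PMF α) (f g : α → ℝ≥0∞) :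
    mean μ (fun a => f a + g a) = mean μ f + mean μ g := by
  simp only [mean, mul_add, ENNReal.tsum_add]

theorem mean_mul_left (μ : PMF α) (c : ℝ≥0∞) (f : α → ℝ≥0∞) :
    mean μ (fun a => c * f a) = c * mean μ f := by
  simp only [mean, ← ENNReal.tsum_mul_left, mul_left_comm]

theorem mean_mono (μ : PMF α) {f g : α → ℝ≥0∞} (h : ∀ a, f a ≤ g a) : mean μ f ≤ mean μ g :=
  ENNReal.tsum_le_tsum fun a => mul_le_mul_right (h a) _

theorem mean_zero (μ : PMF α) : mean μ (fun _ => 0) = 0 := by simp [mean]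

theorem mean_fintype [Fintype α] (μ : PMF α) (f : α → ℝ≥0∞) : mean μ f = ∑ a, μ a * f a :=
  tsum_fintype _

theorem mean_indicator [DecidableEq α] (μ : PMF α) (p : α) :
    mean μ (fun a => if a = p then 1 else 0) = μ p := by
  rw [mean, tsum_eq_single p]
  · simp
  · intro b hb
    simp [hb]

theorem sum_toReal_eq_one [Fintype α] (μ : PMF α) : ∑ a, (μ a).toReal = 1 := by
  rw [← ENNReal.toReal_sum fun a _ => μ.apply_ne_top a, ← tsum_fintype (L := .unconditional α),
    μ.tsum_coe, ENNReal.toReal_one]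

theorem mean_ofReal [Fintype α] (μ : PMF α) {f : α → ℝ} (hf : ∀ a, 0 ≤ f a) :
    mean μ (fun a => ENNReal.ofReal (f a)) = ENNReal.ofReal (∑ a, (μ a).toReal * f a) := by
  rw [mean_fintype, ENNReal.ofReal_sum_of_nonneg fun a _ => mul_nonneg ENNReal.toReal_nonneg (hf a)]
  refine Finset.sum_congr rfl fun a _ => ?_
  rw [ENNReal.ofReal_mul ENNReal.toReal_nonneg, ENNReal.ofReal_toReal (μ.apply_ne_top a)]

end Mean

/-! ### The law of the interaction and its occupation probabilities. -/

section Interaction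

variable {S A : Type}

namespace NonstationaryMDP

theorem mean_runLaw_succ (M : NonstationaryMDP S A) (alg : Algorithm S A) (t : ℕ)
    (f : History S A × S → ℝ≥0∞) :
    mean (M.runLaw alg (t + 1)) f =
      mean (M.runLaw alg t) fun hs => mean (alg hs.1 hs.2) fun a =>
        mean (M.rewardLaw t hs.2 a) fun x => mean (M.trans t hs.2 a) fun y =>
          f (hs.1 ++ [(hs.2, a, x)], y) := by
  simp only [runLaw, mean_bind, mean_map]

theorem mean_stateActionLaw (M : NonstationaryMDP S A) (alg : Algorithm S A) (t : ℕ)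
    (f : S × A → ℝ≥0∞) :
    mean (M.stateActionLaw alg t) f =
      mean (M.runLaw alg t) fun hs => mean (alg hs.1 hs.2) fun a => f (hs.2, a) := by
  simp only [stateActionLaw, mean_bind, mean_map]

/-- Causality: kernels from time `t` on do not affect what is seen up to `t`. This lets the
adversary fix the blocks one after another. -/
theorem runLaw_congr {M M' : NonstationaryMDP S A} (alg : Algorithm S A) (hi : M.init = M'.init)
    (hr : M.rewardLaw = M'.rewardLaw) {t : ℕ} (ht : ∀ i < t, M.trans i = M'.trans i) :
    M.runLaw alg t = M'.runLaw alg t := by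
  induction t with
  | zero => simp only [runLaw, hi]
  | succ t ih =>
    simp only [runLaw, ih fun i hi => ht i (by omega), hr, ht t (by omega)]

theorem stateActionLaw_congr {M M' : NonstationaryMDP S A} (alg : Algorithm S A)
    (hi : M.init = M'.init) (hr : M.rewardLaw = M'.rewardLaw) {t : ℕ}
    (ht : ∀ i < t, M.trans i = M'.trans i) :
    M.stateActionLaw alg t = M'.stateActionLaw alg t := by
  simp only [stateActionLaw, runLaw_congr alg hi hr ht]

/-- The probability that `alg` is in state `p.1` and takes action `p.2` at time `t`. -/
def occ (M : NonstationaryMDP S A) (alg : Algorithm S A) (t : ℕ) (p : S × A) : ℝ :=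
  (M.stateActionLaw alg t p).toReal

theorem occ_nonneg (M : NonstationaryMDP S A) (alg : Algorithm S A) (t : ℕ) (p : S × A) :
    0 ≤ M.occ alg t p := ENNReal.toReal_nonneg

variable [Fintype S] [Fintype A]

theorem sum_occ (M : NonstationaryMDP S A) (alg : Algorithm S A) (t : ℕ) :
    ∑ p, M.occ alg t p = 1 := sum_toReal_eq_one _

theorem sum_occ_eq [DecidableEq S] (M : NonstationaryMDP S A) (alg : Algorithm S A) (t : ℕ)
    (y : S) : ENNReal.ofReal (∑ a, M.occ alg t (y, a)) =
      mean (M.runLaw alg t) fun hs => if hs.2 = y then 1 else 0 := by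
  have h1 : ∑ a, M.occ alg t (y, a) =
      ∑ p, (M.stateActionLaw alg t p).toReal * (if p.1 = y then 1 else 0) := by
    rw [Fintype.sum_prod_type, Finset.sum_eq_single y]
    · simp [occ]
    · intro b _ hb
      simp [hb]
    · simp
  rw [h1, ← mean_ofReal _ (fun p => by split_ifs <;> norm_num), mean_stateActionLaw]
  congr 1
  ext hs
  split_ifs
  · simp only [mean, ENNReal.ofReal_one, mul_one, PMF.tsum_coe]
  · simp only [ENNReal.ofReal_zero, mean_zero]

theorem sum_occ_zero [DecidableEq S] (M : NonstationaryMDP S A) (alg : Algorithm S A) (y : S) :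
    ∑ a, M.occ alg 0 (y, a) = if M.init = y then 1 else 0 := by
  have h := M.sum_occ_eq alg 0 y
  rw [runLaw, mean_pure] at h
  have h2 := congrArg ENNReal.toReal h
  rw [ENNReal.toReal_ofReal (Finset.sum_nonneg fun a _ => M.occ_nonneg alg 0 _)] at h2
  rw [h2]
  split_ifs <;> simp

theorem sum_occ_succ [DecidableEq S] (M : NonstationaryMDP S A) (alg : Algorithm S A) (t : ℕ)
    (y : S) :
    ∑ a, M.occ alg (t + 1) (y, a) =
      ∑ p : S × A, M.occ alg t p * (M.trans t p.1 p.2 y).toReal := by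
  have h := M.sum_occ_eq alg (t + 1) y
  rw [mean_runLaw_succ] at h
  have h1 : (mean (M.runLaw alg t) fun hs => mean (alg hs.1 hs.2) fun a =>
        mean (M.rewardLaw t hs.2 a) fun _ => mean (M.trans t hs.2 a) fun z =>
          if z = y then 1 else 0) =
      mean (M.stateActionLaw alg t)
        fun p => ENNReal.ofReal (M.trans t p.1 p.2 y).toReal := by
    rw [mean_stateActionLaw]
    simp only [mean_indicator, ENNReal.ofReal_toReal (PMF.apply_ne_top _ _)]
    congr 1
    ext hs
    congr 1
    ext a
    rw [mean, ENNReal.tsum_mul_right, PMF.tsum_coe, one_mul]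
  rw [h1, mean_ofReal _ fun p => ENNReal.toReal_nonneg] at h
  rw [ENNReal.ofReal_eq_ofReal_iff (Finset.sum_nonneg fun a _ => M.occ_nonneg alg _ _)
    (Finset.sum_nonneg fun p _ => mul_nonneg ENNReal.toReal_nonneg ENNReal.toReal_nonneg)] at h
  exact h

end NonstationaryMDP

/-! ### Change of measure for the number of visits to one state-action pair. -/

variable [Fintype S] [Fintype A] [DecidableEq S] [DecidableEq A]

/-- The expected number of times among the next `k` at which `alg`, having seen the history
`h` and being in state `s`, takes the state-action pair `p` in the stationary MDP with
transitions `P` and deterministic rewards `r`. -/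
def futureVisits (P : TransitionKernel S A) (r : S → A → ℝ) (alg : Algorithm S A) (p : S × A) :
    ℕ → History S A → S → ℝ
  | 0, _, _ => 0
  | k + 1, h, s => ∑ a, (alg h s a).toReal * ((if (s, a) = p then 1 else 0) +
      ∑ y, (P s a y).toReal * futureVisits P r alg p k (h ++ [(s, a, r s a)]) y)

variable (P : TransitionKernel S A) (r : S → A → ℝ) (alg : Algorithm S A) (p : S × A)

theorem futureVisits_nonneg (k : ℕ) (h : History S A) (s : S) :
    0 ≤ futureVisits P r alg p k h s := by
  induction k generalizing h s with
  | zero => exact le_rfl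
  | succ k ih =>
    refine Finset.sum_nonneg fun a _ => mul_nonneg ENNReal.toReal_nonneg (add_nonneg ?_ ?_)
    · split_ifs <;> norm_num
    · exact Finset.sum_nonneg fun y _ => mul_nonneg ENNReal.toReal_nonneg (ih _ _)

theorem sum_toReal_mul_le {α : Type*} [Fintype α] (μ : PMF α) {f : α → ℝ} {c : ℝ}
    (hf : ∀ a, f a ≤ c) : ∑ a, (μ a).toReal * f a ≤ c := by
  calc ∑ a, (μ a).toReal * f a ≤ ∑ a, (μ a).toReal * c :=
        Finset.sum_le_sum fun a _ => mul_le_mul_of_nonneg_left (hf a) ENNReal.toReal_nonneg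
    _ = c := by rw [← Finset.sum_mul, sum_toReal_eq_one, one_mul]

theorem futureVisits_le (k : ℕ) (h : History S A) (s : S) :
    futureVisits P r alg p k h s ≤ k := by
  induction k generalizing h s with
  | zero => simp [futureVisits]
  | succ k ih =>
    refine sum_toReal_mul_le _ fun a => ?_
    have h1 := sum_toReal_mul_le (P s a) fun y => ih (h ++ [(s, a, r s a)]) y
    push_cast
    split_ifs <;> linarith

theorem ofReal_futureVisits_succ (k : ℕ) (h : History S A) (s : S) :
    ENNReal.ofReal (futureVisits P r alg p (k + 1) h s) =
      mean (alg h s) fun a => (if (s, a) = p then 1 else 0) +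
        mean (P s a) fun y => ENNReal.ofReal (futureVisits P r alg p k (h ++ [(s, a, r s a)]) y) := by
  have hn : ∀ a, 0 ≤ ∑ y, (P s a y).toReal *
      futureVisits P r alg p k (h ++ [(s, a, r s a)]) y := fun a =>
    Finset.sum_nonneg fun y _ => mul_nonneg ENNReal.toReal_nonneg (futureVisits_nonneg _ _ _ _ _ _ _)
  rw [futureVisits, ← mean_ofReal]
  · congr 1
    ext a
    rw [ENNReal.ofReal_add (by split_ifs <;> norm_num) (hn a),
      mean_ofReal _ fun y => futureVisits_nonneg _ _ _ _ _ _ _]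
    congr 1
    split_ifs <;> simp
  · intro a
    exact add_nonneg (by split_ifs <;> norm_num) (hn a)

/-- Links the recursion conditional on a history to the law of the actual run. Rewards must be
deterministic since `futureVisits` appends `r s a` itself. -/
theorem mean_futureVisits (M : NonstationaryMDP S A) (k t : ℕ)
    (hP : ∀ i < k, M.trans (t + i) = P)
    (hr : ∀ t s a, M.rewardLaw t s a = PMF.pure (r s a)) :
    mean (M.runLaw alg t) (fun hs => ENNReal.ofReal (futureVisits P r alg p k hs.1 hs.2)) =
      ∑ i ∈ Finset.range k, M.stateActionLaw alg (t + i) p := by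
  induction k generalizing t with
  | zero => simp [futureVisits, mean_zero]
  | succ k ih =>
    simp only [ofReal_futureVisits_succ, mean_add]
    rw [Finset.sum_range_succ', add_comm]
    congr 1
    · have h1 := ih (t + 1) fun i hi => by
        rw [add_assoc, add_comm 1 i]
        exact hP (i + 1) (by omega)
      rw [M.mean_runLaw_succ] at h1
      have h0 := hP 0 (by omega)
      rw [add_zero] at h0
      simp only [hr, mean_pure, h0] at h1
      rw [h1]
      refine Finset.sum_congr rfl fun i _ => ?_
      rw [add_assoc, add_comm 1 i]
    · rw [← M.mean_stateActionLaw alg t fun q => if q = p then 1 else 0, mean_indicator, add_zero]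

/-- A change of measure inequality: the mean of `log w` under `q` is at most the logarithm of
the mean of `w` under `p`, plus the chi-square divergence of `q` from `p`. -/
theorem sum_mul_log_le {ι : Type*} [Fintype ι] (q p w : ι → ℝ) (hq : ∀ i, 0 ≤ q i)
    (hq1 : ∑ i, q i = 1) (hp : ∀ i, 0 ≤ p i) (hpq : ∀ i, p i = 0 → q i = 0)
    (hw : ∀ i, 0 < w i) :
    ∑ i, q i * Real.log (w i) ≤ Real.log (∑ i, p i * w i) + ∑ i, q i * (q i / p i - 1) := by
  set m := ∑ i, p i * w i with hm
  have hm0 : 0 < m := by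
    obtain ⟨i, hi⟩ : ∃ i, q i ≠ 0 := by
      by_contra! hcon
      simp [hcon] at hq1
    refine Finset.sum_pos' (fun j _ => mul_nonneg (hp j) (hw j).le) ⟨i, Finset.mem_univ _, ?_⟩
    exact mul_pos (lt_of_le_of_ne (hp i) fun h => hi (hpq i h.symm)) (hw i)
  have key : ∀ i, q i * Real.log (w i) ≤
      q i * Real.log m + (p i * w i / m - q i) + q i * (q i / p i - 1) := by
    intro i
    rcases (hq i).eq_or_lt with h0 | h0
    · rw [← h0]
      have := div_nonneg (mul_nonneg (hp i) (hw i).le) hm0.le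
      linarith
    · have hpi : 0 < p i := lt_of_le_of_ne (hp i) fun h => h0.ne' (hpq i h.symm)
      -- After this splitting, `log x ≤ x - 1` is applied to the last two terms: one gives Gibbs'
      -- variational inequality, the other bounds relative entropy by chi-square.
      have e : Real.log (w i) =
          Real.log m + Real.log (w i * p i / (m * q i)) + Real.log (q i / p i) := by
        rw [← Real.log_mul hm0.ne' (by have := hw i; positivity),
          ← Real.log_mul (by have := hw i; positivity) (by positivity)]
        congr 1
        field_simp
      have l1 := Real.log_le_sub_one_of_pos
        (show 0 < w i * p i / (m * q i) by have := hw i; positivity)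
      have l2 := Real.log_le_sub_one_of_pos (show 0 < q i / p i by positivity)
      have e2 : p i * w i / m - q i = q i * (w i * p i / (m * q i) - 1) := by
        field_simp
      rw [e, e2]
      nlinarith
  calc ∑ i, q i * Real.log (w i)
      ≤ ∑ i, (q i * Real.log m + (p i * w i / m - q i) + q i * (q i / p i - 1)) :=
        Finset.sum_le_sum fun i _ => key i
    _ = _ := by
        rw [Finset.sum_add_distrib, Finset.sum_add_distrib, Finset.sum_sub_distrib,
          ← Finset.sum_mul, ← Finset.sum_div, hq1, ← hm, div_self hm0.ne']
        ring

/-- Jensen's inequality, as the case of equal laws, where the divergence vanishes. -/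
theorem sum_mul_log_le_log_sum {ι : Type*} [Fintype ι] (μ : PMF ι) (w : ι → ℝ)
    (hw : ∀ i, 0 < w i) :
    ∑ i, (μ i).toReal * Real.log (w i) ≤ Real.log (∑ i, (μ i).toReal * w i) := by
  have h := sum_mul_log_le (fun i => (μ i).toReal) (fun i => (μ i).toReal) w
    (fun _ => ENNReal.toReal_nonneg) (sum_toReal_eq_one μ) (fun _ => ENNReal.toReal_nonneg)
    (fun _ h => h) hw
  have h2 : ∑ i, (μ i).toReal * ((μ i).toReal / (μ i).toReal - 1) = 0 := by
    refine Finset.sum_eq_zero fun i _ => ?_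
    by_cases h0 : (μ i).toReal = 0
    · simp [h0]
    · simp [div_self h0]
  linarith

variable {P p} in
/-- If the kernels `P` and `Q` differ only at the pair `p`, with chi-square divergence at most
`c` there, then the numbers of future visits of `p` under `P` and `Q` are comparable. -/
theorem futureVisits_log_le {Q : TransitionKernel S A} {c b β : ℝ}
    (hPQ : ∀ s a, (s, a) ≠ p → P s a = Q s a)
    (habs : ∀ y, P p.1 p.2 y = 0 → Q p.1 p.2 y = 0)
    (hc : ∑ y, (Q p.1 p.2 y).toReal *
      ((Q p.1 p.2 y).toReal / (P p.1 p.2 y).toReal - 1) ≤ c)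
    (hβ : 0 < β) (hb : b < 1) (k : ℕ) (hk : β * k ≤ b) (h : History S A) (s : S) :
    -(c + β / (1 - b)) * futureVisits Q r alg p k h s ≤
      Real.log (1 - β * futureVisits P r alg p k h s) := by
  induction k generalizing h s with
  | zero => simp [futureVisits]
  | succ k ih =>
    push_cast at hk
    have hk' : β * k ≤ b := by linarith
    specialize ih hk'
    -- `Λ` is the price of one visit to `p`: `c` for changing the measure, `β / (1 - b)` for the
    -- loss in the logarithm when the count grows by one.
    set Λ := c + β / (1 - b)
    have hlt : ∀ h y, 0 < 1 - β * futureVisits P r alg p k h y := fun h y => by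
      have := mul_le_mul_of_nonneg_left (futureVisits_le P r alg p k h y) hβ.le
      linarith
    have hsumw : ∀ (μ : PMF S) (h : History S A), ∑ y, (μ y).toReal *
        (1 - β * futureVisits P r alg p k h y) =
        1 - β * ∑ y, (μ y).toReal * futureVisits P r alg p k h y := fun μ h => by
      simp only [mul_sub, mul_one, Finset.sum_sub_distrib, sum_toReal_eq_one, Finset.mul_sum]
      congr 1
      exact Finset.sum_congr rfl fun _ _ => by ring
    have hQ : ∀ (μ : PMF S) (h : History S A),
        -Λ * ∑ y, (μ y).toReal * futureVisits Q r alg p k h y ≤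
        ∑ y, (μ y).toReal * Real.log (1 - β * futureVisits P r alg p k h y) := fun μ h => by
      rw [Finset.mul_sum]
      refine Finset.sum_le_sum fun y _ => ?_
      have := mul_le_mul_of_nonneg_left (ih h y) (ENNReal.toReal_nonneg (a := μ y))
      linarith
    have hstep : ∀ a, (0 < 1 - β * ((if (s, a) = p then 1 else 0) +
        ∑ y, (P s a y).toReal * futureVisits P r alg p k (h ++ [(s, a, r s a)]) y)) ∧
        -Λ * ((if (s, a) = p then 1 else 0) +
        ∑ y, (Q s a y).toReal * futureVisits Q r alg p k (h ++ [(s, a, r s a)]) y) ≤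
        Real.log (1 - β * ((if (s, a) = p then 1 else 0) +
        ∑ y, (P s a y).toReal * futureVisits P r alg p k (h ++ [(s, a, r s a)]) y)) := by
      intro a
      set h' := h ++ [(s, a, r s a)]
      have hx : ∑ y, (P s a y).toReal * futureVisits P r alg p k h' y ≤ k :=
        sum_toReal_mul_le _ fun y => futureVisits_le _ _ _ _ _ _ _
      have hx' := mul_le_mul_of_nonneg_left hx hβ.le
      have h1 := hQ (Q s a) h'
      split_ifs with hp
      · refine ⟨by linarith, ?_⟩
        subst hp
        -- Only here do the kernels differ, so only here is the divergence paid.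
        have h2 := sum_mul_log_le (fun y => (Q s a y).toReal) (fun y => (P s a y).toReal)
          (fun y => 1 - β * futureVisits P r alg (s, a) k h' y)
          (fun _ => ENNReal.toReal_nonneg) (sum_toReal_eq_one _)
          (fun _ => ENNReal.toReal_nonneg) (fun y hy => by
            have := habs y ((ENNReal.toReal_eq_zero_iff _).1 hy |>.resolve_right
              (PMF.apply_ne_top _ _))
            simp only at this
            simp [this]) (hlt h')
        rw [hsumw] at h2
        set x := ∑ y, (P s a y).toReal * futureVisits P r alg (s, a) k h' y
        have hpos : 0 < 1 - β * (1 + x) := by linarith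
        have hpos' : 0 < 1 - β * x := by linarith
        have l1 := Real.log_le_sub_one_of_pos (div_pos hpos' hpos)
        rw [Real.log_div hpos'.ne' hpos.ne'] at l1
        have l2 : (1 - β * x) / (1 - β * (1 + x)) - 1 ≤ β / (1 - b) := by
          rw [div_sub_one hpos.ne']
          have : 1 - β * x - (1 - β * (1 + x)) = β := by ring
          rw [this]
          exact div_le_div_of_nonneg_left hβ.le (by linarith) (by linarith)
        simp only at hc
        have : -Λ * (1 + ∑ y, (Q s a y).toReal * futureVisits Q r alg (s, a) k h' y) =
          -c - β / (1 - b) +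
            -Λ * ∑ y, (Q s a y).toReal * futureVisits Q r alg (s, a) k h' y := by
          simp only [Λ]; ring
        rw [this]
        linarith
      · rw [zero_add, zero_add]
        refine ⟨by linarith, ?_⟩
        -- Away from `p` the kernels agree and Jensen costs nothing.
        have h2 := sum_mul_log_le_log_sum (P s a) _ (hlt h')
        rw [hsumw] at h2
        rw [← hPQ s a hp] at h1 ⊢
        exact h1.trans h2
    have hJ := sum_mul_log_le_log_sum (alg h s) _ fun a => (hstep a).1
    have e : ∑ a, (alg h s a).toReal * (1 - β * ((if (s, a) = p then 1 else 0) +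
        ∑ y, (P s a y).toReal * futureVisits P r alg p k (h ++ [(s, a, r s a)]) y)) =
        1 - β * futureVisits P r alg p (k + 1) h s := by
      rw [futureVisits]
      simp only [mul_sub, mul_one, Finset.sum_sub_distrib, sum_toReal_eq_one, Finset.mul_sum]
      congr 1
      exact Finset.sum_congr rfl fun _ _ => by ring
    rw [e] at hJ
    refine le_trans ?_ hJ
    rw [futureVisits, Finset.mul_sum]
    refine Finset.sum_le_sum fun a _ => ?_
    have := mul_le_mul_of_nonneg_left (hstep a).2 (ENNReal.toReal_nonneg (a := alg h s a))
    linarith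

variable {P p} in
-- `log (1 - x) ≤ -x` turns the logarithmic bound into a linear one, which is averaged over the
-- common law of the history at time `t`.
theorem sum_occ_le_of_kernels {Q : TransitionKernel S A} {c b β : ℝ}
    (hPQ : ∀ s a, (s, a) ≠ p → P s a = Q s a)
    (habs : ∀ y, P p.1 p.2 y = 0 → Q p.1 p.2 y = 0)
    (hc : ∑ y, (Q p.1 p.2 y).toReal *
      ((Q p.1 p.2 y).toReal / (P p.1 p.2 y).toReal - 1) ≤ c) (hc0 : 0 ≤ c)
    (hβ : 0 < β) (hb : b < 1) {k : ℕ} (hk : β * k ≤ b)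
    {M M' : NonstationaryMDP S A} {t : ℕ} (hM : M.runLaw alg t = M'.runLaw alg t)
    (hP : ∀ i < k, M.trans (t + i) = P) (hQ : ∀ i < k, M'.trans (t + i) = Q)
    (hr : ∀ t s a, M.rewardLaw t s a = PMF.pure (r s a))
    (hr' : ∀ t s a, M'.rewardLaw t s a = PMF.pure (r s a)) :
    ∑ i ∈ Finset.range k, M.occ alg (t + i) p ≤
      ((c + β / (1 - b)) / β) * ∑ i ∈ Finset.range k, M'.occ alg (t + i) p := by
  have hΛ : 0 ≤ (c + β / (1 - b)) / β := by
    have : 0 ≤ β / (1 - b) := div_nonneg hβ.le (by linarith)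
    positivity
  have hle : ∀ h s, futureVisits P r alg p k h s ≤
      ((c + β / (1 - b)) / β) * futureVisits Q r alg p k h s := by
    intro h s
    have h1 := futureVisits_log_le r alg hPQ habs hc hβ hb k hk h s
    have hlt : 0 < 1 - β * futureVisits P r alg p k h s := by
      have := mul_le_mul_of_nonneg_left (futureVisits_le P r alg p k h s) hβ.le
      linarith
    have h2 := Real.log_le_sub_one_of_pos hlt
    rw [div_mul_eq_mul_div, le_div_iff₀ hβ]
    linarith
  have hsum : ∀ N : NonstationaryMDP S A, ∑ i ∈ Finset.range k, N.occ alg (t + i) p =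
      (∑ i ∈ Finset.range k, N.stateActionLaw alg (t + i) p).toReal := fun N =>
    (ENNReal.toReal_sum fun i _ => PMF.apply_ne_top _ _).symm
  have hfin : ∑ i ∈ Finset.range k, M'.stateActionLaw alg (t + i) p ≠ ⊤ :=
    (ENNReal.sum_lt_top.2 fun i _ => PMF.apply_lt_top _ _).ne
  rw [hsum, hsum, ← ENNReal.toReal_ofReal hΛ, ← ENNReal.toReal_mul]
  refine ENNReal.toReal_mono (ENNReal.mul_ne_top ENNReal.ofReal_ne_top hfin) ?_
  rw [← mean_futureVisits P r alg p M k t hP hr, ← mean_futureVisits Q r alg p M' k t hQ hr',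
    ← mean_mul_left, hM]
  refine mean_mono _ fun hs => ?_
  rw [← ENNReal.ofReal_mul hΛ]
  exact ENNReal.ofReal_le_ofReal (hle _ _)

end Interaction

end

/-! ### The family of hard instances and their kernels. -/

noncomputable section

variable {S A : Type}

section Mix

variable [Fintype S] [DecidableEq S]

/-- The law of a random variable that is `u` with probability `p` and `v` otherwise. -/
def mix (p : ℝ) (hp : p ∈ Set.Icc (0 : ℝ) 1) (u v : S) : PMF S :=
  PMF.ofFintype (fun y => ENNReal.ofReal
    (p * (if y = u then 1 else 0) + (1 - p) * (if y = v then 1 else 0))) (by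
      rw [← ENNReal.ofReal_sum_of_nonneg]
      · simp [Finset.sum_add_distrib]
      · intro y _
        have h0 := hp.1
        have h1 := sub_nonneg.2 hp.2
        split_ifs <;> linarith)

theorem mix_toReal {p : ℝ} (hp : p ∈ Set.Icc (0 : ℝ) 1) (u v y : S) :
    (mix p hp u v y).toReal =
      p * (if y = u then 1 else 0) + (1 - p) * (if y = v then 1 else 0) := by
  rw [mix, PMF.ofFintype_apply, ENNReal.toReal_ofReal]
  have h0 := hp.1
  have h1 := sub_nonneg.2 hp.2
  split_ifs <;> linarith

theorem sum_mix_mul {p : ℝ} (hp : p ∈ Set.Icc (0 : ℝ) 1) (u v : S) (f : S → ℝ) :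
    ∑ y, (mix p hp u v y).toReal * f y = p * f u + (1 - p) * f v := by
  simp [mix_toReal, add_mul, Finset.sum_add_distrib]

end Mix

/-- The shape of the hard instances. From the state `good` one falls to `root` with
probability `δ`; from there actions lead through the inner states to a leaf, from which one
returns to `good` with probability `δ`, or `δ + ε` for one special pair of leaf and action. -/
structure Arena (S A : Type) where
  good : S
  root : S
  leaf : Finset S
  child : S → A → S
  δ : ℝ
  ε : ℝ
  root_ne : root ≠ good
  good_notMem : good ∉ leaf
  child_ne : ∀ s a, child s a ≠ good
  δ_pos : 0 < δ
  ε_pos : 0 < ε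
  add_le : δ + ε ≤ 1 / 2

namespace Arena

variable (R : Arena S A)

theorem ne_good {s : S} (hs : s ∈ R.leaf) : s ≠ R.good := fun h => R.good_notMem (h ▸ hs)

variable [DecidableEq S]

/-- The reward of a state. -/
def rew (s : S) : ℝ := if s = R.good then 1 else if s ∈ R.leaf then 0 else 1 / 2

theorem rew_mem (s : S) : R.rew s ∈ Set.Icc (0 : ℝ) 1 := by
  unfold rew
  split_ifs <;> norm_num

/-- The state to which one moves on. -/
def target (s : S) (a : A) : S :=
  if s = R.good then R.root else if s ∈ R.leaf then R.good else R.child s a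

variable [DecidableEq A]

/-- The probability of moving on from a state. -/
def moveProb (θ : Option (S × A)) (s : S) (a : A) : ℝ :=
  if s = R.good then R.δ else if s ∈ R.leaf then
    (if θ = some (s, a) then R.δ + R.ε else R.δ) else 1

theorem moveProb_mem (θ : Option (S × A)) (s : S) (a : A) :
    R.moveProb θ s a ∈ Set.Icc (0 : ℝ) 1 := by
  have h1 := R.δ_pos
  have h2 := R.ε_pos
  have h3 := R.add_le
  unfold moveProb
  split_ifs <;> constructor <;> linarith

theorem le_moveProb (θ : Option (S × A)) (s : S) (a : A) : R.δ ≤ R.moveProb θ s a := by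
  have h1 := R.δ_pos
  have h2 := R.ε_pos
  have h3 := R.add_le
  unfold moveProb
  split_ifs <;> linarith

theorem abs_moveProb_sub_le (θ θ' : Option (S × A)) (s : S) (a : A) :
    |R.moveProb θ s a - R.moveProb θ' s a| ≤ R.ε := by
  have h2 := R.ε_pos
  unfold moveProb
  rw [abs_le]
  split_ifs <;> constructor <;> linarith

variable [Fintype S]

/-- The transition kernel with the special pair `θ`. -/
def kernel (θ : Option (S × A)) : TransitionKernel S A := fun s a =>
  mix (R.moveProb θ s a) (R.moveProb_mem θ s a) (R.target s a) s

theorem sum_kernel_mul (θ : Option (S × A)) (s : S) (a : A) (f : S → ℝ) :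
    ∑ y, (R.kernel θ s a y).toReal * f y =
      R.moveProb θ s a * f (R.target s a) + (1 - R.moveProb θ s a) * f s :=
  sum_mix_mul _ _ _ _

/-- Written as a sum of indicators so that averaging over the occupation law gives the linear
recursion `goodProb_succ`. -/
theorem kernel_good (θ : Option (S × A)) (s : S) (a : A) :
    (R.kernel θ s a R.good).toReal =
      (1 - R.δ) * (if s = R.good then 1 else 0) + R.δ * (if s ∈ R.leaf then 1 else 0) +
        R.ε * (if s ∈ R.leaf ∧ θ = some (s, a) then 1 else 0) := by
  rw [kernel, mix_toReal]
  unfold moveProb target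
  by_cases h1 : s = R.good
  · subst h1
    simp [R.good_notMem, R.root_ne.symm]
  · by_cases h2 : s ∈ R.leaf
    · by_cases h3 : θ = some (s, a) <;> simp [h1, h2, h3, Ne.symm h1]
    · simp [h1, h2, (R.child_ne s a).symm]

/-- The non-stationary MDP with special pair `θ t` at time `t`. -/
def mdp (θ : ℕ → Option (S × A)) : NonstationaryMDP S A where
  init := R.root
  trans t := R.kernel (θ t)
  rewardLaw _ s _ := PMF.pure (R.rew s)
  reward_mem t s a x hx := by
    rw [PMF.support_pure, Set.mem_singleton_iff] at hx
    rw [hx]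
    exact R.rew_mem s

theorem meanReward_mdp (θ : ℕ → Option (S × A)) (t : ℕ) (s : S) (a : A) :
    (R.mdp θ).meanReward t s a = R.rew s := by
  simp only [NonstationaryMDP.meanReward, mdp, PMF.toMeasure_pure, MeasureTheory.integral_dirac]

theorem kernel_eq_of_ne {p : S × A} {s : S} {a : A} (h : (s, a) ≠ p) :
    R.kernel (some p) s a = R.kernel none s a := by
  have : R.moveProb (some p) s a = R.moveProb none s a := by
    simp [moveProb, Ne.symm h]
  simp only [kernel, this]

theorem kernel_leaf_toReal {θ : Option (S × A)} {p : S × A} (hp : p.1 ∈ R.leaf) (y : S) :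
    (R.kernel θ p.1 p.2 y).toReal =
      (if θ = some p then R.δ + R.ε else R.δ) * (if y = R.good then 1 else 0) +
      (1 - (if θ = some p then R.δ + R.ε else R.δ)) * (if y = p.1 then 1 else 0) := by
  rw [kernel, mix_toReal]
  simp only [moveProb, target, if_neg (R.ne_good hp), if_pos hp]

theorem kernel_abs {p : S × A} (hp : p.1 ∈ R.leaf) (y : S)
    (h : R.kernel (some p) p.1 p.2 y = 0) : R.kernel none p.1 p.2 y = 0 := by
  have h1 := R.kernel_leaf_toReal (θ := some p) hp y
  rw [h, ENNReal.toReal_zero, if_pos rfl] at h1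
  have a1 := R.δ_pos
  have a2 := R.ε_pos
  have a3 := R.add_le
  have h2 := R.kernel_leaf_toReal (θ := none) hp y
  rw [if_neg (by simp)] at h2
  have h3 : (R.kernel none p.1 p.2 y).toReal = 0 := by
    rw [h2]
    split_ifs at h1 ⊢ <;> linarith
  exact ((ENNReal.toReal_eq_zero_iff _).1 h3).resolve_right (PMF.apply_ne_top _ _)

/-- The laws live on two points, with divergence exactly `ε² / ((δ + ε) (1 - δ - ε))`; since `δ + ε
≤ 1/2`, the last factor is at least 1/2. -/
theorem kernel_chi_sq_le {p : S × A} (hp : p.1 ∈ R.leaf) :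
    ∑ y, (R.kernel none p.1 p.2 y).toReal *
      ((R.kernel none p.1 p.2 y).toReal / (R.kernel (some p) p.1 p.2 y).toReal - 1) ≤
      2 * R.ε ^ 2 / R.δ := by
  have a1 := R.δ_pos
  have a2 := R.ε_pos
  have a3 := R.add_le
  rw [sum_kernel_mul]
  simp only [R.kernel_leaf_toReal hp]
  have h1 := R.ne_good hp
  simp only [moveProb, target, if_neg h1, if_pos hp, if_neg h1.symm, if_true, reduceCtorEq,
    if_false, mul_one, mul_zero, add_zero, zero_add]
  have b1 : 0 < 1 - (R.δ + R.ε) := by linarith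
  have e : R.δ * (R.δ / (R.δ + R.ε) - 1) + (1 - R.δ) * ((1 - R.δ) / (1 - (R.δ + R.ε)) - 1) =
      R.ε ^ 2 / ((R.δ + R.ε) * (1 - (R.δ + R.ε))) := by
    field_simp
    ring
  rw [e, div_le_div_iff₀ (by positivity) a1]
  have : R.δ ≤ 2 * ((R.δ + R.ε) * (1 - (R.δ + R.ε))) := by nlinarith
  nlinarith [sq_nonneg R.ε]

/-! ### Flow balance, and the adversarial choice of special pairs. -/

variable [Fintype A] (alg : Algorithm S A) (θ : ℕ → Option (S × A))

/-- The probability of being in the good state at time `t`. -/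
def goodProb (t : ℕ) : ℝ :=
  ∑ p : S × A, (R.mdp θ).occ alg t p * (if p.1 = R.good then 1 else 0)

/-- The probability of being in a leaf at time `t`. -/
def leafProb (t : ℕ) : ℝ :=
  ∑ p : S × A, (R.mdp θ).occ alg t p * (if p.1 ∈ R.leaf then 1 else 0)

/-- The probability of choosing the special pair at time `t`. -/
def specialProb (t : ℕ) : ℝ :=
  ∑ p : S × A, (R.mdp θ).occ alg t p * (if p.1 ∈ R.leaf ∧ θ t = some p then 1 else 0)

theorem goodProb_eq_sum (t : ℕ) : R.goodProb alg θ t = ∑ a, (R.mdp θ).occ alg t (R.good, a) := by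
  rw [goodProb, Fintype.sum_prod_type, Finset.sum_eq_single R.good]
  · simp
  · intro b _ hb
    simp [hb]
  · simp

theorem goodProb_zero : R.goodProb alg θ 0 = 0 := by
  rw [goodProb_eq_sum, NonstationaryMDP.sum_occ_zero, if_neg]
  exact R.root_ne

theorem goodProb_succ (t : ℕ) : R.goodProb alg θ (t + 1) =
    (1 - R.δ) * R.goodProb alg θ t + R.δ * R.leafProb alg θ t +
      R.ε * R.specialProb alg θ t := by
  rw [goodProb_eq_sum, NonstationaryMDP.sum_occ_succ, goodProb, leafProb, specialProb,
    Finset.mul_sum, Finset.mul_sum, Finset.mul_sum, ← Finset.sum_add_distrib,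
    ← Finset.sum_add_distrib]
  refine Finset.sum_congr rfl fun p _ => ?_
  have h := R.kernel_good (θ t) p.1 p.2
  change _ * (R.kernel (θ t) p.1 p.2 R.good).toReal = _
  rw [h]
  ring

theorem goodProb_nonneg (t : ℕ) : 0 ≤ R.goodProb alg θ t :=
  Finset.sum_nonneg fun p _ => mul_nonneg ENNReal.toReal_nonneg (by split_ifs <;> norm_num)

theorem goodProb_add_leafProb_le (t : ℕ) :
    R.goodProb alg θ t + R.leafProb alg θ t ≤ 1 := by
  refine le_trans ?_ ((R.mdp θ).sum_occ alg t).le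
  rw [goodProb, leafProb, ← Finset.sum_add_distrib]
  refine Finset.sum_le_sum fun p _ => ?_
  have h0 := (R.mdp θ).occ_nonneg alg t p
  by_cases h1 : p.1 = R.good
  · simp [h1, R.good_notMem]
  · rw [if_neg h1]
    split_ifs <;> linarith

theorem leafProb_nonneg (t : ℕ) : 0 ≤ R.leafProb alg θ t :=
  Finset.sum_nonneg fun p _ => mul_nonneg ENNReal.toReal_nonneg (by split_ifs <;> norm_num)

theorem expectedReward_eq (t : ℕ) : (R.mdp θ).expectedReward alg t =
    1 / 2 + (R.goodProb alg θ t - R.leafProb alg θ t) / 2 := by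
  have h : ∀ p : S × A, (R.mdp θ).occ alg t p * R.rew p.1 = (R.mdp θ).occ alg t p * (1 / 2) +
      ((R.mdp θ).occ alg t p * (if p.1 = R.good then 1 else 0) -
        (R.mdp θ).occ alg t p * (if p.1 ∈ R.leaf then 1 else 0)) / 2 := by
    intro p
    unfold rew
    by_cases h1 : p.1 = R.good
    · simp [h1, R.good_notMem]; ring
    · by_cases h2 : p.1 ∈ R.leaf <;> simp [h1, h2]; ring
  simp only [NonstationaryMDP.expectedReward, meanReward_mdp]
  change ∑ p : S × A, (R.mdp θ).occ alg t p * R.rew p.1 = _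
  rw [Finset.sum_congr rfl fun p _ => h p, Finset.sum_add_distrib, ← Finset.sum_mul,
    NonstationaryMDP.sum_occ, ← Finset.sum_div, Finset.sum_sub_distrib, one_mul]
  rfl

/-- Solving the recursion for `goodProb - leafProb` leaves the special visits and a telescoping
difference, which has the right sign because the run starts outside the good state. -/
theorem sum_expectedReward_le (T : ℕ) :
    ∑ t ∈ Finset.range T, (R.mdp θ).expectedReward alg t ≤
      T / 2 + R.ε / (2 * R.δ) * ∑ t ∈ Finset.range T, R.specialProb alg θ t := by
  have hδ := R.δ_pos
  have h : ∀ t, (R.mdp θ).expectedReward alg t = 1 / 2 + R.ε / (2 * R.δ) * R.specialProb alg θ t -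
      (R.goodProb alg θ (t + 1) - R.goodProb alg θ t) / (2 * R.δ) := by
    intro t
    rw [expectedReward_eq, goodProb_succ]
    field_simp
    ring
  have htel : ∑ t ∈ Finset.range T, (R.goodProb alg θ (t + 1) - R.goodProb alg θ t) / (2 * R.δ) =
      R.goodProb alg θ T / (2 * R.δ) := by
    rw [← Finset.sum_div, Finset.sum_range_sub, goodProb_zero, sub_zero]
  rw [Finset.sum_congr rfl fun t _ => h t, Finset.sum_sub_distrib, Finset.sum_add_distrib,
    ← Finset.mul_sum, htel]
  have := div_nonneg (R.goodProb_nonneg alg θ T) (by positivity : 0 ≤ 2 * R.δ)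
  simp only [Finset.sum_const, Finset.card_range, nsmul_eq_mul]
  linarith

/-- With equal rates in both directions, leaves and good state receive equal time up to `1/δ`, and
together at most `k`. -/
theorem sum_leafProb_le {t k : ℕ} (h : ∀ i < k, θ (t + i) = none) :
    ∑ i ∈ Finset.range k, R.leafProb alg θ (t + i) ≤ (k + 1 / R.δ) / 2 := by
  have hδ := R.δ_pos
  have h1 : ∀ i ∈ Finset.range k, R.leafProb alg θ (t + i) = R.goodProb alg θ (t + i) +
      (R.goodProb alg θ (t + (i + 1)) - R.goodProb alg θ (t + i)) / R.δ := by
    intro i hi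
    have h0 : R.specialProb alg θ (t + i) = 0 := by
      simp [specialProb, h i (Finset.mem_range.1 hi)]
    rw [← add_assoc, goodProb_succ, h0]
    field_simp
    ring
  have h2 : ∑ i ∈ Finset.range k, (R.goodProb alg θ (t + i) + R.leafProb alg θ (t + i)) ≤ k := by
    calc _ ≤ ∑ i ∈ Finset.range k, (1 : ℝ) :=
          Finset.sum_le_sum fun i _ => R.goodProb_add_leafProb_le alg θ _
      _ = k := by simp
  have h3 := Finset.sum_congr rfl h1
  rw [Finset.sum_add_distrib, ← Finset.sum_div,
    Finset.sum_range_sub fun i => R.goodProb alg θ (t + i)] at h3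
  rw [Finset.sum_add_distrib] at h2
  have h4 : (R.goodProb alg θ (t + k) - R.goodProb alg θ (t + 0)) / R.δ ≤ 1 / R.δ := by
    refine div_le_div_of_nonneg_right ?_ hδ.le
    have a1 := R.goodProb_nonneg alg θ (t + 0)
    have a2 := R.goodProb_add_leafProb_le alg θ (t + k)
    have a3 := R.leafProb_nonneg alg θ (t + k)
    linarith
  linarith

theorem leafProb_eq_sum (t : ℕ) :
    R.leafProb alg θ t = ∑ p ∈ R.leaf ×ˢ Finset.univ, (R.mdp θ).occ alg t p := by
  rw [leafProb]
  simp only [mul_ite, mul_one, mul_zero]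
  rw [← Finset.sum_filter]
  refine Finset.sum_congr ?_ fun _ _ => rfl
  ext p
  simp

/-- Pigeonhole over the leaf-action pairs. -/
theorem exists_sum_occ_le {t k : ℕ} (h : ∀ i < k, θ (t + i) = none) (hne : R.leaf.Nonempty)
    [Nonempty A] : ∃ p : S × A, p.1 ∈ R.leaf ∧
      ∑ i ∈ Finset.range k, (R.mdp θ).occ alg (t + i) p ≤
        (k + 1 / R.δ) / (2 * (R.leaf.card * Fintype.card A)) := by
  by_contra! hcon
  have hlt : ∑ _p ∈ R.leaf ×ˢ (Finset.univ : Finset A),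
      (k + 1 / R.δ) / (2 * (R.leaf.card * Fintype.card A)) <
      ∑ p ∈ R.leaf ×ˢ Finset.univ, ∑ i ∈ Finset.range k, (R.mdp θ).occ alg (t + i) p :=
    Finset.sum_lt_sum_of_nonempty (hne.product Finset.univ_nonempty) fun p hp =>
      hcon p (Finset.mem_product.1 hp).1
  rw [Finset.sum_comm] at hlt
  simp only [← leafProb_eq_sum] at hlt
  have h1 := R.sum_leafProb_le alg θ h
  have hc : (0 : ℝ) < R.leaf.card := by exact_mod_cast hne.card_pos
  have hA : (0 : ℝ) < Fintype.card A := by exact_mod_cast Fintype.card_pos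
  rw [Finset.sum_const, nsmul_eq_mul, Finset.card_product, Finset.card_univ] at hlt
  push_cast at hlt
  have e : (R.leaf.card : ℝ) * Fintype.card A *
      ((k + 1 / R.δ) / (2 * (R.leaf.card * Fintype.card A))) = (k + 1 / R.δ) / 2 := by
    field_simp
  linarith

theorem specialProb_of_eq_some {t : ℕ} {p : S × A} (h : θ t = some p) (hp : p.1 ∈ R.leaf) :
    R.specialProb alg θ t = (R.mdp θ).occ alg t p := by
  rw [specialProb, Finset.sum_eq_single p]
  · simp [h, hp]
  · intro b _ hb
    simp [h, Ne.symm hb]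
  · simp

theorem specialProb_congr {θ θ' : ℕ → Option (S × A)} {t : ℕ} (h : ∀ i ≤ t, θ i = θ' i) :
    R.specialProb alg θ t = R.specialProb alg θ' t := by
  have : (R.mdp θ).stateActionLaw alg t = (R.mdp θ').stateActionLaw alg t :=
    NonstationaryMDP.stateActionLaw_congr (M := R.mdp θ) (M' := R.mdp θ') alg rfl rfl fun i hi => by
      simp only [mdp, h i hi.le]
  simp only [specialProb, NonstationaryMDP.occ, this, h t le_rfl]

/-- On a stretch of time on which the special pair is `p`, the expected number of choices of
`p` is at most a constant times what it would be without a special pair. -/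
theorem sum_occ_special_le {θ θ' : ℕ → Option (S × A)} {t k τ : ℕ} {p : S × A}
    (hp : p.1 ∈ R.leaf) (hτ : 0 < τ) (hk : k ≤ τ) (h : ∀ i < t, θ i = θ' i)
    (hθ : ∀ i < k, θ (t + i) = some p) (hθ' : ∀ i < k, θ' (t + i) = none) :
    ∑ i ∈ Finset.range k, (R.mdp θ).occ alg (t + i) p ≤
      (20 * R.ε ^ 2 * τ / R.δ + 10 / 9) *
        ∑ i ∈ Finset.range k, (R.mdp θ').occ alg (t + i) p := by
  have hδ := R.δ_pos
  have hτ' : (0 : ℝ) < τ := by exact_mod_cast hτ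
  have hk' : (k : ℝ) ≤ τ := by exact_mod_cast hk
  -- With `β = 1/(10 τ)` and `b = 1/10` the factor `(c + β/(1-b))/β` is `10 τ c + 10/9`.
  have key := sum_occ_le_of_kernels (P := R.kernel (some p)) (p := p) (fun s _ => R.rew s) alg
    (Q := R.kernel none) (c := 2 * R.ε ^ 2 / R.δ) (b := 1 / 10) (β := 1 / (10 * τ)) (k := k)
    (fun s a hsa => R.kernel_eq_of_ne hsa) (fun y => R.kernel_abs hp y) (R.kernel_chi_sq_le hp)
    (by positivity) (by positivity) (by norm_num)
    (by rw [div_mul_eq_mul_div, div_le_div_iff₀ (by positivity) (by norm_num)]; linarith)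
    (M := R.mdp θ) (M' := R.mdp θ') (t := t)
    (NonstationaryMDP.runLaw_congr (M := R.mdp θ) (M' := R.mdp θ') alg rfl rfl
      fun i hi => by simp only [mdp, h i hi])
    (fun i hi => by simp only [mdp, hθ i hi]) (fun i hi => by simp only [mdp, hθ' i hi])
    (fun _ _ _ => rfl) (fun _ _ _ => rfl)
  convert key using 2
  field_simp
  ring

/-- Against every algorithm the special pairs of consecutive blocks of length `τ` can be chosen
such that the algorithm rarely chooses them. -/
theorem exists_rarely_special (hne : R.leaf.Nonempty) [Nonempty A] {τ : ℕ} (hτ : 0 < τ)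
    (T L : ℕ) : ∃ σ : ℕ → Option (S × A), (∀ j, L ≤ j → σ j = none) ∧
      (∀ j < L, ∃ p, σ j = some p ∧ p.1 ∈ R.leaf) ∧
      ∑ t ∈ Finset.range (min T (L * τ)), R.specialProb alg (fun t => σ (t / τ)) t ≤
        (20 * R.ε ^ 2 * τ / R.δ + 10 / 9) * ((min T (L * τ) : ℕ) + L / R.δ) /
          (2 * (R.leaf.card * Fintype.card A)) := by
  induction L with
  | zero => exact ⟨fun _ => none, by simp⟩
  | succ L ih =>
    obtain ⟨σ, h1, h2, h3⟩ := ih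
    have hδ := R.δ_pos
    set K := 20 * R.ε ^ 2 * τ / R.δ + 10 / 9 with hK
    have hK0 : 0 ≤ K := by positivity
    -- `k` is the length of block `L` cut off at `T`; if it is positive, all earlier blocks are
    -- complete.
    obtain ⟨k, hkτ, hk⟩ : ∃ k ≤ τ, min T ((L + 1) * τ) = min T (L * τ) + k ∧
        (0 < k → min T (L * τ) = L * τ) := by
      refine ⟨min T ((L + 1) * τ) - min T (L * τ), ?_, ?_, ?_⟩ <;>
      · rw [add_mul, one_mul]
        omega
    set t := min T (L * τ) with ht
    have hdiv : ∀ i < k, (t + i) / τ = L := fun i hi => by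
      rw [hk.2 (by omega)]
      rw [mul_comm, Nat.mul_add_div hτ, Nat.div_eq_of_lt (by omega), add_zero]
    have hdiv' : ∀ i < t, i / τ < L := fun i hi => by
      rw [Nat.div_lt_iff_lt_mul hτ]
      omega
    have hnone : ∀ i < k, (fun t => σ (t / τ)) (t + i) = none := fun i hi => by
      simp only [hdiv i hi]
      exact h1 L le_rfl
    -- The pair is selected in the run with no special pair on block `L`, then made special there.
    obtain ⟨p, hp, hle⟩ := R.exists_sum_occ_le alg (fun t => σ (t / τ)) hnone hne
    refine ⟨Function.update σ L (some p), ?_, ?_, ?_⟩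
    · intro j hj
      rw [Function.update_of_ne (by omega)]
      exact h1 j (by omega)
    · intro j hj
      rcases eq_or_ne j L with rfl | hjL
      · exact ⟨p, by simp, hp⟩
      · rw [Function.update_of_ne hjL]
        exact h2 j (by omega)
    · have hsome : ∀ i < k, (fun t => Function.update σ L (some p) (t / τ)) (t + i) = some p :=
        fun i hi => by simp only [hdiv i hi, Function.update_self]
      have hsame : ∀ i < t, (fun t => Function.update σ L (some p) (t / τ)) i =
          (fun t => σ (t / τ)) i := fun i hi => by
        have := hdiv' i hi
        simp only [Function.update_of_ne this.ne]
      rw [hk.1, Finset.sum_range_add]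
      have e1 : ∑ i ∈ Finset.range t,
          R.specialProb alg (fun t => Function.update σ L (some p) (t / τ)) i =
          ∑ i ∈ Finset.range t, R.specialProb alg (fun t => σ (t / τ)) i :=
        Finset.sum_congr rfl fun i hi => R.specialProb_congr alg fun j hj =>
          hsame j (lt_of_le_of_lt hj (Finset.mem_range.1 hi))
      have e2 : ∑ i ∈ Finset.range k,
          R.specialProb alg (fun t => Function.update σ L (some p) (t / τ)) (t + i) =
          ∑ i ∈ Finset.range k,
            (R.mdp fun t => Function.update σ L (some p) (t / τ)).occ alg (t + i) p :=
        Finset.sum_congr rfl fun i hi =>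
          R.specialProb_of_eq_some alg _ (hsome i (Finset.mem_range.1 hi)) hp
      rw [e1, e2]
      have h4 := R.sum_occ_special_le alg hp hτ hkτ hsame hsome hnone
      have h5 := mul_le_mul_of_nonneg_left hle hK0
      have e3 : K * (((t + k : ℕ) : ℝ) + (L + 1 : ℕ) / R.δ) /
          (2 * (R.leaf.card * Fintype.card A)) =
          K * ((t : ℝ) + L / R.δ) / (2 * (R.leaf.card * Fintype.card A)) +
          K * ((k + 1 / R.δ) / (2 * (R.leaf.card * Fintype.card A))) := by
        push_cast
        ring
      rw [e3]
      exact add_le_add h3 (h4.trans h5)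

end Arena

end

/-! ### Average reward, diameter and variation of the instances. -/

noncomputable section

variable {S A : Type} [Fintype S]

theorem totalReward_le (P : TransitionKernel S A) {r : S → A → ℝ} (hr : ∀ s a, r s a ≤ 1)
    (π : S → A) (n : ℕ) (s : S) : totalReward P r π n s ≤ n := by
  induction n generalizing s with
  | zero => simp [totalReward]
  | succ n ih =>
    have h1 := sum_toReal_mul_le (P s (π s)) fun y => ih y
    have h2 := hr s (π s)
    rw [totalReward]
    push_cast
    linarith

theorem le_averageReward {P : TransitionKernel S A} {r : S → A → ℝ} (hr : ∀ s a, r s a ≤ 1)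
    {π : S → A} {s : S} {ρ K : ℝ} (h : ∀ n : ℕ, n * ρ - K ≤ totalReward P r π n s) :
    ρ ≤ averageReward P r π s := by
  have hlim : Filter.Tendsto (fun n : ℕ => ρ - K / n) Filter.atTop (nhds ρ) := by
    simpa using tendsto_const_nhds.sub (tendsto_const_div_atTop_nhds_zero_nat K)
  rw [averageReward, ← hlim.liminf_eq]
  refine Filter.liminf_le_liminf ?_ hlim.isBoundedUnder_ge ?_
  · filter_upwards [Filter.eventually_gt_atTop 0] with n hn
    have hn' : (0 : ℝ) < n := by exact_mod_cast hn
    rw [le_div_iff₀ hn', sub_mul, div_mul_cancel₀ _ hn'.ne', mul_comm]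
    exact h n
  · refine Filter.IsBoundedUnder.isCoboundedUnder_ge ⟨1, ?_⟩
    simp only [Filter.eventually_map]
    filter_upwards with n
    exact div_le_one_of_le₀ (totalReward_le P hr π n s) (Nat.cast_nonneg n)

theorem averageReward_le_optimal [Finite A] (P : TransitionKernel S A) (r : S → A → ℝ)
    (π : S → A) (s : S) : averageReward P r π s ≤ optimalAverageReward P r :=
  (le_ciSup (f := fun s => averageReward P r π s) (Set.finite_range _).bddAbove s).trans
    (le_ciSup (f := fun π => ⨆ s, averageReward P r π s) (Set.finite_range _).bddAbove π)

/-- Drift criterion: a nonnegative potential that drops by at least one in mean per step bounds the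
hitting time. The induction is on partial sums of the tail series. -/
theorem expectedHittingTime_le {P : TransitionKernel S A} {π : S → A} {goal : S} {V : S → ℝ}
    (hV : ∀ s, 0 ≤ V s)
    (h : ∀ s, s ≠ goal → 1 + ∑ y, (P s (π s) y).toReal * V y ≤ V s) (s : S) :
    expectedHittingTime P π goal s ≤ ENNReal.ofReal (V s) := by
  refine ENNReal.tsum_le_of_sum_range_le fun n => ?_
  induction n generalizing s with
  | zero => simp
  | succ n ih =>
    by_cases hs : s = goal
    · refine le_trans (le_of_eq ?_) zero_le
      refine Finset.sum_eq_zero fun i _ => ?_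
      cases i <;> simp [avoidProb, hs]
    · rw [Finset.sum_range_succ']
      simp only [avoidProb, if_neg hs]
      rw [Finset.sum_comm]
      simp only [← Finset.mul_sum]
      refine le_trans ?_ (ENNReal.ofReal_le_ofReal (h s hs))
      rw [add_comm, ENNReal.ofReal_add zero_le_one (Finset.sum_nonneg fun y _ =>
        mul_nonneg ENNReal.toReal_nonneg (hV y)), ← mean_ofReal _ hV, mean_fintype,
        ENNReal.ofReal_one]
      gcongr with y _
      exact ih y

namespace Arena

variable [DecidableEq S] [DecidableEq A] (R : Arena S A)

/-- From the root one can steer to every state other than the good one, and from every inner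
state to a leaf, in at most `B` steps. -/
structure Navigable (R : Arena S A) (B : ℕ) : Prop where
  reach : ∀ x, x ≠ R.good → ∃ (π : S → A) (I : Set S) (d : S → ℕ), R.root ∈ I ∧ x ∈ I ∧
    R.good ∉ I ∧ ∀ s ∈ I, d s ≤ B ∧ (s ≠ x → s ∉ R.leaf ∧ R.child s (π s) ∈ I ∧
      d (R.child s (π s)) + 1 ≤ d s)
  descend : ∃ (π : S → A) (e : S → ℕ), ∀ s, e s ≤ B ∧
    (s ≠ R.good → s ∉ R.leaf → e (R.child s (π s)) + 1 ≤ e s)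

theorem sum_kernel_mul_le {θ : Option (S × A)} {s : S} {a : A} {V : S → ℝ}
    (h : 1 ≤ R.moveProb θ s a * (V s - V (R.target s a))) :
    1 + ∑ y, (R.kernel θ s a y).toReal * V y ≤ V s := by
  rw [sum_kernel_mul]
  linarith

variable {R} in
-- Potentials for the drift criterion. Only the lower bound `δ` on move probabilities enters, so `θ`
-- is arbitrary.
theorem Navigable.diameter_le {B : ℕ} (hB : R.Navigable B) (θ : Option (S × A)) :
    diameter (R.kernel θ) ≤ ENNReal.ofReal (2 / R.δ + 2 * B) := by
  have hδ := R.δ_pos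
  have hinv : 0 ≤ 1 / R.δ := by positivity
  have h2 : 2 / R.δ = 1 / R.δ + 1 / R.δ := by ring
  have hmul : ∀ s a (v : ℝ), 1 / R.δ ≤ v → 1 ≤ R.moveProb θ s a * v := by
    intro s a v hv
    calc (1 : ℝ) = R.δ * (1 / R.δ) := by field_simp
      _ ≤ _ := mul_le_mul (R.le_moveProb θ s a) hv hinv (R.moveProb_mem θ s a).1
  have hin : ∀ s a, s ≠ R.good → s ∉ R.leaf → R.moveProb θ s a = 1 ∧
      R.target s a = R.child s a := fun s a h h' => by simp [moveProb, target, h, h']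
  obtain ⟨π₀, e, he⟩ := hB.descend
  have heB : ∀ s, (e s : ℝ) ≤ B := fun s => by exact_mod_cast (he s).1
  refine iSup_le fun s => iSup_le fun x => iSup_le fun _ => ?_
  by_cases hx : x = R.good
  · subst hx
    set V : S → ℝ := fun s => if s = R.good then 0 else 1 / R.δ + e s with hV
    refine (iInf_le _ π₀).trans ((expectedHittingTime_le (V := V) ?_ ?_ s).trans
      (ENNReal.ofReal_le_ofReal ?_))
    · intro s
      simp only [hV]
      split_ifs <;> positivity
    · intro s hs
      refine R.sum_kernel_mul_le ?_
      by_cases hl : s ∈ R.leaf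
      · refine hmul _ _ _ ?_
        simp only [hV, target, if_neg hs, if_pos hl, if_true, sub_zero]
        exact le_add_of_nonneg_right (Nat.cast_nonneg _)
      · rw [(hin s _ hs hl).1, (hin s _ hs hl).2, one_mul]
        simp only [hV, if_neg hs, if_neg (R.child_ne _ _)]
        have : ((e (R.child s (π₀ s)) + 1 : ℕ) : ℝ) ≤ e s := by exact_mod_cast (he s).2 hs hl
        push_cast at this
        linarith
    · simp only [hV]
      have := heB s
      have hB0 : (0 : ℝ) ≤ B := Nat.cast_nonneg _
      split_ifs
      · positivity
      · linarith
  · obtain ⟨π, I, d, hr, hxI, hg, hI⟩ := hB.reach x hx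
    classical
    have hdB : ∀ s ∈ I, (d s : ℝ) ≤ B := fun s hs => by exact_mod_cast (hI s hs).1
    -- Off the route set `I` one descends to a leaf, waits for the good state, waits again for the
    -- root, and then follows the route.
    set V : S → ℝ := fun s => if s = R.good then 1 / R.δ + d R.root else
      if s ∈ I then d s else 2 / R.δ + B + e s with hV
    refine (iInf_le _ fun s => if s ∈ I then π s else π₀ s).trans
      ((expectedHittingTime_le (V := V) ?_ ?_ s).trans (ENNReal.ofReal_le_ofReal ?_))
    · intro s
      simp only [hV]
      split_ifs <;> positivity
    · intro s hs
      refine R.sum_kernel_mul_le ?_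
      by_cases hsg : s = R.good
      · refine hmul _ _ _ ?_
        simp only [hV, target, hsg, if_true, if_neg R.root_ne, if_pos hr]
        linarith
      · by_cases hsI : s ∈ I
        · obtain ⟨hl, hc, hd⟩ := (hI s hsI).2 hs
          rw [(hin s _ hsg hl).1, (hin s _ hsg hl).2, one_mul]
          simp only [hV, if_neg hsg, if_pos hsI, if_neg (R.child_ne _ _), if_pos hc]
          have : ((d (R.child s (π s)) + 1 : ℕ) : ℝ) ≤ d s := by exact_mod_cast hd
          push_cast at this
          linarith
        · have hrB := hdB _ hr
          have he0 : (0 : ℝ) ≤ e s := Nat.cast_nonneg _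
          by_cases hl : s ∈ R.leaf
          · refine hmul _ _ _ ?_
            simp only [hV, target, if_neg hsg, if_pos hl, if_neg hsI, if_true]
            linarith
          · rw [(hin s _ hsg hl).1, (hin s _ hsg hl).2, one_mul]
            simp only [hV, if_neg hsg, if_neg hsI, if_neg (R.child_ne _ _)]
            have h1 : ((e (R.child s (π₀ s)) + 1 : ℕ) : ℝ) ≤ e s := by
              exact_mod_cast (he s).2 hsg hl
            push_cast at h1
            have h0 : (0 : ℝ) ≤ e (R.child s (π₀ s)) := Nat.cast_nonneg _
            split_ifs with hc
            · have := hdB _ hc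
              linarith
            · linarith
    · simp only [hV]
      have := heB s
      have hrB := hdB _ hr
      have hB0 : (0 : ℝ) ≤ B := Nat.cast_nonneg _
      split_ifs with h1 h3
      · linarith
      · have := hdB _ h3
        linarith
      · linarith

variable {R} in
-- The policy walks to `x` and plays `a` there. A bias function `g` satisfying the Poisson
-- inequality with gain `1/2 + κ` certifies its average reward.
theorem Navigable.le_optimalAverageReward [Finite A] {B : ℕ} (hB : R.Navigable B) {x : S} {a : A}
    (hx : x ∈ R.leaf) (hε : R.ε ≤ R.δ / 20) (hδB : R.δ * B ≤ 1 / 10) :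
    1 / 2 + R.ε / (5 * R.δ) ≤
      optimalAverageReward (R.kernel (some (x, a))) fun s _ => R.rew s := by
  have hδ := R.δ_pos
  have hε0 := R.ε_pos
  have hxg := R.ne_good hx
  obtain ⟨π, I, d, hr, hxI, hg, hI⟩ := hB.reach x hxg
  set κ := R.ε / (5 * R.δ) with hκ
  have hκ0 : 0 < κ := by positivity
  have hdB : ∀ s ∈ I, (d s : ℝ) ≤ B := fun s hs => by exact_mod_cast (hI s hs).1
  -- `H` is the bias that makes the Poisson inequality hold at the special leaf.
  set H := (1 / 2 + κ) / (R.δ + R.ε) with hH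
  have hH0 : 0 < H := by positivity
  have hHε : (R.δ + R.ε) * H = 1 / 2 + κ := by rw [hH]; field_simp
  set π' : S → A := fun s => if s = x then a else π s with hπ'
  set g : S → ℝ := fun s => if s = R.good then H else -(κ * d s) with hgdef
  refine le_trans (le_averageReward (π := π') (s := R.root) (K := H - g R.root)
    (fun s _ => (R.rew_mem s).2) fun n => ?_) (averageReward_le_optimal _ _ _ _)
  have key : ∀ (n : ℕ) (s : S), s = R.good ∨ s ∈ I → n * (1 / 2 + κ) - (H - g s) ≤
      totalReward (R.kernel (some (x, a))) (fun s _ => R.rew s) π' n s := by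
    intro n
    induction n with
    | zero =>
      intro s _
      have : g s ≤ H := by
        simp only [hgdef]
        have : 0 ≤ κ * d s := by positivity
        split_ifs <;> linarith
      simp only [totalReward]
      push_cast
      linarith
    | succ n ih =>
      intro s hs
      rw [totalReward, sum_kernel_mul]
      set m := R.moveProb (some (x, a)) s (π' s) with hm
      have hm1 : 0 ≤ m ∧ m ≤ 1 := R.moveProb_mem _ _ _
      have hmain : (R.target s (π' s) = R.good ∨ R.target s (π' s) ∈ I) ∧
          1 / 2 + κ ≤ R.rew s + m * (g (R.target s (π' s)) - g s) := by
        rcases hs with hs | hs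
        · subst hs
          have et : R.target R.good (π' R.good) = R.root := by simp [target]
          rw [et]
          refine ⟨Or.inr hr, ?_⟩
          have em : m = R.δ := by simp [hm, moveProb]
          have er : R.rew R.good = 1 := by simp [rew]
          rw [em, er]
          simp only [hgdef, if_neg R.root_ne, if_true]
          have h1 : R.δ * d R.root ≤ 1 / 10 :=
            (mul_le_mul_of_nonneg_left (hdB _ hr) hδ.le).trans hδB
          have h3 : κ * (R.δ * d R.root) ≤ κ * (1 / 10) := mul_le_mul_of_nonneg_left h1 hκ0.le
          have h5 : R.δ * H = 1 / 2 + κ - R.ε * H := by linarith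
          -- The inequality at the good state: `2κ` for the gain and `κ/10` for the walk from the
          -- root.
          have h6 : κ * (21 / 10) ≤ R.ε * H := by
            have h7 : 21 / (50 * R.δ) ≤ H := by
              rw [hH, div_le_div_iff₀ (by positivity) (by positivity)]
              nlinarith
            calc κ * (21 / 10) = R.ε * (21 / (50 * R.δ)) := by rw [hκ]; field_simp; norm_num
              _ ≤ R.ε * H := mul_le_mul_of_nonneg_left h7 hε0.le
          linarith
        · have hsg : s ≠ R.good := fun h => hg (h ▸ hs)
          by_cases hsx : s = x
          · subst hsx
            have et : R.target s (π' s) = R.good := by simp [target, hsg, hx]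
            rw [et]
            refine ⟨Or.inl rfl, ?_⟩
            have em : m = R.δ + R.ε := by simp [hm, moveProb, hsg, hx, hπ']
            have er : R.rew s = 0 := by simp [rew, hsg, hx]
            rw [em, er]
            simp only [hgdef, if_true, if_neg hsg]
            have : 0 ≤ (R.δ + R.ε) * (κ * d s) := by positivity
            linarith
          · obtain ⟨hl, hc, hd⟩ := (hI s hs).2 hsx
            have eπ : π' s = π s := by simp [hπ', hsx]
            have et : R.target s (π' s) = R.child s (π s) := by simp [target, hsg, hl, eπ]
            rw [et]
            refine ⟨Or.inr hc, ?_⟩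
            have em : m = 1 := by simp [hm, moveProb, hsg, hl]
            have er : R.rew s = 1 / 2 := by simp [rew, hsg, hl]
            rw [em, er]
            simp only [hgdef, if_neg hsg, if_neg (R.child_ne _ _)]
            have h1 : ((d (R.child s (π s)) + 1 : ℕ) : ℝ) ≤ d s := by exact_mod_cast hd
            push_cast at h1
            have := mul_le_mul_of_nonneg_left h1 hκ0.le
            linarith
      have i1 := mul_le_mul_of_nonneg_left (ih _ hmain.1) hm1.1
      have i2 := mul_le_mul_of_nonneg_left (ih s hs) (sub_nonneg.2 hm1.2)
      have i3 := hmain.2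
      push_cast
      linarith
  exact key n _ (Or.inr hr)

theorem sum_abs_kernel_sub_le (θ θ' : Option (S × A)) (s : S) (a : A) :
    ∑ y, |(R.kernel θ s a y).toReal - (R.kernel θ' s a y).toReal| ≤ 2 * R.ε := by
  set m := R.moveProb θ s a
  set m' := R.moveProb θ' s a
  set u := R.target s a
  calc ∑ y, |(R.kernel θ s a y).toReal - (R.kernel θ' s a y).toReal|
      ≤ ∑ y, (|m - m'| * (if y = u then 1 else 0) + |m - m'| * (if y = s then 1 else 0)) := by
        refine Finset.sum_le_sum fun y _ => ?_
        simp only [kernel, mix_toReal]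
        have e : m * (if y = u then 1 else 0) + (1 - m) * (if y = s then 1 else 0) -
            (m' * (if y = u then 1 else 0) + (1 - m') * (if y = s then 1 else 0)) =
            (m - m') * (if y = u then 1 else 0) + -((m - m') * (if y = s then 1 else 0)) := by
          ring
        rw [e]
        refine (abs_add_le _ _).trans (le_of_eq ?_)
        rw [abs_neg, abs_mul, abs_mul]
        congr 2 <;> split_ifs <;> simp
    _ = 2 * |m - m'| := by simp [Finset.sum_add_distrib, two_mul]
    _ ≤ _ := mul_le_mul_of_nonneg_left (R.abs_moveProb_sub_le θ θ' s a) zero_le_two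

theorem rewardVariation_mdp (θ : ℕ → Option (S × A)) (T : ℕ) : (R.mdp θ).rewardVariation T = 0 := by
  simp [NonstationaryMDP.rewardVariation, meanReward_mdp]

/-- Only block boundaries contribute; they are counted by the telescoping increments of `t / τ`. -/
theorem totalVariation_mdp_le [Fintype A] [Nonempty A] (σ : ℕ → Option (S × A)) (τ T : ℕ) :
    (R.mdp fun t => σ (t / τ)).totalVariation T ≤ 2 * R.ε * ((T - 1) / τ : ℕ) := by
  have : Nonempty S := ⟨R.good⟩
  have hε := R.ε_pos
  rw [NonstationaryMDP.totalVariation, rewardVariation_mdp, zero_add,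
    NonstationaryMDP.transitionVariation]
  calc _ ≤ ∑ t ∈ Finset.range (T - 1),
        2 * R.ε * (((t + 1) / τ : ℕ) - (t / τ : ℕ) : ℝ) := by
        refine Finset.sum_le_sum fun t _ => ciSup_le fun p => ?_
        simp only [mdp]
        have hmono : t / τ ≤ (t + 1) / τ := Nat.div_le_div_right (by omega)
        rcases hmono.eq_or_lt with h | h
        · simp [← h]
        · refine (R.sum_abs_kernel_sub_le _ _ _ _).trans ?_
          have : ((t / τ : ℕ) : ℝ) + 1 ≤ ((t + 1) / τ : ℕ) := by exact_mod_cast h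
          nlinarith
    _ = _ := by
        rw [← Finset.mul_sum, Finset.sum_range_sub fun t => ((t / τ : ℕ) : ℝ)]
        simp

end Arena

end

/-! ### The `A`-ary heap as a tree of logarithmic depth. -/

noncomputable section

theorem iterate_parent_le (A u k : ℕ) : (fun v => (v - 1) / A)^[k] u ≤ u / A ^ k := by
  induction k with
  | zero => simp
  | succ k ih =>
    rw [Function.iterate_succ_apply', pow_succ, ← Nat.div_div_eq_div_mul]
    exact Nat.div_le_div_right ((Nat.sub_le _ _).trans ih)

/-- The arena on `Fin S` whose states other than the last one form an `A`-ary heap. -/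
def heapArena {S A : ℕ} (hS : 2 ≤ S) {δ ε : ℝ} (hδ : 0 < δ) (hε : 0 < ε)
    (h : δ + ε ≤ 1 / 2) : Arena (Fin S) (Fin A) where
  good := ⟨S - 1, by omega⟩
  root := ⟨0, by omega⟩
  -- The nodes whose first child would fall outside the heap; for `S = 2` the root itself is a leaf.
  leaf := Finset.univ.filter fun i => i.val < S - 1 ∧ S - 1 ≤ A * i.val + 1
  -- Clipping handles inner nodes with fewer than `A` children.
  child i a := ⟨min (A * i.val + a.val + 1) (S - 2), by omega⟩
  δ := δ
  ε := ε
  root_ne := by simp only [ne_eq, Fin.mk.injEq]; omega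
  good_notMem := by simp
  child_ne s a := by simp only [ne_eq, Fin.mk.injEq]; omega
  δ_pos := hδ
  ε_pos := hε
  add_le := h

section HeapArena

variable {S A : ℕ} (hS : 2 ≤ S) {δ ε : ℝ} (hδ : 0 < δ) (hε : 0 < ε)
  (h : δ + ε ≤ 1 / 2)

theorem heapArena_leaf_card (hA : 2 ≤ A) :
    S ≤ 4 * (heapArena (A := A) hS hδ hε h).leaf.card := by
  have hsub : Finset.Ico (⟨(S - 1) / 2, by omega⟩ : Fin S) ⟨S - 1, by omega⟩ ⊆
      (heapArena (A := A) hS hδ hε h).leaf := by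
    intro i hi
    rw [Finset.mem_Ico, Fin.le_def, Fin.lt_def] at hi
    simp only at hi
    simp only [heapArena, Finset.mem_filter, Finset.mem_univ, true_and]
    have := Nat.mul_le_mul_right i.val hA
    omega
  have hcard := Finset.card_le_card hsub
  rw [Fin.card_Ico] at hcard
  simp only at hcard
  omega

theorem heapArena_navigable (hA : 2 ≤ A) :
    (heapArena (A := A) hS hδ hε h).Navigable (Nat.log A S + 1) := by
  set B := Nat.log A S + 1 with hB
  have hSB : S < A ^ B := Nat.lt_pow_succ_log_self (by omega) S
  constructor
  · intro x hx
    have hxS : x.val ≤ S - 2 := by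
      have h1 := x.isLt
      have h2 : x.val ≠ S - 1 := fun h => hx (Fin.ext h)
      omega
    set par : ℕ → ℕ := fun v => (v - 1) / A with hpar
    have hzero : ∀ k, B ≤ k → par^[k] x = 0 := fun k hk => by
      have h1 := iterate_parent_le A x k
      rw [Nat.div_eq_of_lt] at h1
      · exact Nat.le_zero.1 h1
      · have := Nat.pow_le_pow_right (show 0 < A by omega) hk
        omega
    have hle : ∀ k, par^[k] x ≤ x := fun k => (iterate_parent_le A x k).trans (Nat.div_le_self _ _)
    classical
    -- The route is the ancestor chain of `x`. As `par` fixes 0 by truncated subtraction, the root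
    -- occurs for many `k`, and the least one is its distance to `x`.
    set d : Fin S → ℕ := fun s => if hs : ∃ k, par^[k] x = s.val then Nat.find hs else 0 with hd
    refine ⟨fun s => ⟨(par^[d s - 1] x - 1) % A, Nat.mod_lt _ (by omega)⟩,
      {s | ∃ k, par^[k] x = s.val}, d, ⟨B, hzero B le_rfl⟩, ⟨0, rfl⟩, ?_, ?_⟩
    · rintro ⟨k, hk⟩
      have := hle k
      simp only [heapArena] at hk
      omega
    · intro s hs
      have hds : d s = Nat.find hs := dif_pos hs
      constructor
      · rw [hds]
        obtain ⟨k, hk⟩ := id hs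
        rcases le_total k B with hkB | hkB
        · exact (Nat.find_min' hs hk).trans hkB
        · refine Nat.find_min' hs ?_
          rw [hzero B le_rfl, ← hk, hzero k hkB]
      · intro hsx
        have hspec := Nat.find_spec hs
        rw [← hds] at hspec
        obtain ⟨j, hj⟩ : ∃ j, d s = j + 1 := by
          refine Nat.exists_eq_succ_of_ne_zero fun h0 => hsx ?_
          rw [h0] at hspec
          exact Fin.ext hspec.symm
        rw [hj, Function.iterate_succ_apply'] at hspec
        have hmin : par^[j] x ≠ s.val := Nat.find_min hs (by omega)
        set u := par^[j] x with hu
        have huS : u ≤ S - 2 := (hle j).trans hxS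
        have hu0 : u ≠ 0 := fun h0 => hmin (by rw [← hspec, h0]; simp [hpar])
        simp only [hpar] at hspec
        have hdiv := Nat.div_add_mod (u - 1) A
        rw [hspec] at hdiv
        have hchild : (heapArena hS hδ hε h).child s
            ⟨(par^[d s - 1] x - 1) % A, Nat.mod_lt _ (by omega)⟩ = ⟨u, by omega⟩ := by
          simp only [heapArena, hj, Nat.add_sub_cancel, ← hu, Fin.mk.injEq]
          omega
        rw [hchild]
        refine ⟨?_, ⟨j, rfl⟩, ?_⟩
        · simp only [heapArena, Finset.mem_filter, Finset.mem_univ, true_and]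
          omega
        · have hmem : ∃ k, par^[k] x = (⟨u, by omega⟩ : Fin S).val := ⟨j, rfl⟩
          have : d ⟨u, by omega⟩ ≤ j := by
            simp only [hd]
            rw [dif_pos hmem]
            exact Nat.find_min' _ rfl
          omega
  -- The last action sends `s` to `A * (s + 1)`, so `log A (s + 1)` grows by at least one per step,
  -- unless clipping lands on `S - 2`, a leaf.
  · refine ⟨fun _ => ⟨A - 1, by omega⟩, fun s => if s ∈ (heapArena (A := A) hS hδ hε h).leaf then 0
      else B - Nat.log A (s.val + 1), fun s => ⟨?_, fun hs hl => ?_⟩⟩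
    · beta_reduce
      split_ifs <;> omega
    · have hlog : ∀ v : Fin S, Nat.log A (v.val + 1) < B := fun v =>
        Nat.lt_succ_of_le (Nat.log_mono_right v.isLt)
      beta_reduce
      rw [if_neg hl]
      split_ifs with hc
      · have := hlog s
        omega
      · simp only [heapArena, Finset.mem_filter, Finset.mem_univ, true_and] at hc
        have h1 := hlog ((heapArena hS hδ hε h).child s (⟨A - 1, by omega⟩ : Fin A))
        have hval : ((heapArena hS hδ hε h).child s (⟨A - 1, by omega⟩ : Fin A)).val =
            A * (s.val + 1) := by
          simp only [heapArena]
          have e : A * (s.val + 1) = A * s.val + A := by ring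
          by_contra hne
          have hmin : min (A * s.val + (A - 1) + 1) (S - 2) = S - 2 := by omega
          rw [hmin] at hc
          have := Nat.mul_le_mul_right (S - 2) hA
          omega
        have h2 : Nat.log A (s.val + 1) + 1 ≤
            Nat.log A (((heapArena hS hδ hε h).child s (⟨A - 1, by omega⟩ : Fin A)).val + 1) := by
          rw [← Nat.log_mul_base (by omega) (by omega), hval, mul_comm]
          exact Nat.log_mono_right (Nat.le_succ _)
        omega

end HeapArena

end

/-! ### The regret bound, choice of parameters and conclusion. -/

noncomputable section

/-- The regret of every algorithm on a suitable non-stationary MDP with a given shape. -/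
theorem Arena.exists_regret_ge {S A : Type} [Fintype S] [DecidableEq S] [Fintype A]
    [DecidableEq A] [Nonempty A] (R : Arena S A) {B : ℕ} (hB : R.Navigable B)
    (hε : R.ε ≤ R.δ / 20) (hδB : R.δ * B ≤ 1 / 10) {n : ℝ}
    (hn : n = R.leaf.card * Fintype.card A) (hn2 : 2 ≤ n) {τ T : ℕ}
    (hτT : τ ≤ T) (hτ : 40 ≤ τ * R.δ) (hτn : R.ε ^ 2 * τ / R.δ ≤ n / 200)
    (alg : Algorithm S A) :
    ∃ σ : ℕ → Option (S × A),
      T * (R.ε / R.δ) / 100 ≤ (R.mdp fun t => σ (t / τ)).dynamicRegret alg T := by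
  have hδ := R.δ_pos
  have hε0 := R.ε_pos
  have hτ0 : 0 < τ := by
    by_contra h0
    have : τ = 0 := by omega
    subst this
    norm_num at hτ
  have hτ' : (0 : ℝ) < τ := by exact_mod_cast hτ0
  have hτT' : (τ : ℝ) ≤ T := by exact_mod_cast hτT
  have hne : R.leaf.Nonempty := by
    rw [Finset.nonempty_iff_ne_empty]
    intro h0
    rw [h0] at hn
    norm_num at hn
    linarith
  obtain ⟨σ, -, h2, h3⟩ := R.exists_rarely_special alg hne hτ0 T (T / τ + 1)
  refine ⟨σ, ?_⟩
  have hTL : T ≤ (T / τ + 1) * τ := by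
    rw [mul_comm]
    exact (Nat.lt_mul_div_succ T hτ0).le
  rw [min_eq_left hTL, ← hn] at h3
  set N := ∑ t ∈ Finset.range T, R.specialProb alg (fun t => σ (t / τ)) t with hN
  -- There are at most `2T/τ` blocks, each with boundary cost `1/δ`, and `τ δ ≥ 40`.
  have hL : ((T / τ + 1 : ℕ) : ℝ) / R.δ ≤ T / 20 := by
    have h4 : ((T / τ : ℕ) : ℝ) ≤ T / τ := Nat.cast_div_le
    have h5 : (1 : ℝ) ≤ T / τ := by rwa [one_le_div hτ']
    have h6 : (T : ℝ) / τ ≤ T * R.δ / 40 := by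
      rw [div_le_div_iff₀ hτ' (by norm_num)]
      have := mul_le_mul_of_nonneg_left hτ (Nat.cast_nonneg (α := ℝ) T)
      linarith
    rw [div_le_iff₀ hδ]
    push_cast
    linarith
  -- For `n ≥ 2` the factor is at most `(1/10 + 5/9) * 21/40 < 7/20`. The regret then keeps at least
  -- `1/5 - 7/40 = 1/40` of `T ε / δ`.
  have hNle : N ≤ 7 / 20 * T := by
    refine h3.trans ?_
    rw [div_le_iff₀ (by linarith)]
    have hT0 : (0 : ℝ) ≤ T := Nat.cast_nonneg _
    have e : 20 * R.ε ^ 2 * τ / R.δ = 20 * (R.ε ^ 2 * τ / R.δ) := by ring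
    rw [e]
    have h7 : 20 * (R.ε ^ 2 * τ / R.δ) + 10 / 9 ≤ n / 10 + 10 / 9 := by linarith
    have h8 : (T : ℝ) + (T / τ + 1 : ℕ) / R.δ ≤ 21 / 20 * T := by linarith
    have h9 : 0 ≤ (T : ℝ) + (T / τ + 1 : ℕ) / R.δ := by positivity
    refine (mul_le_mul h7 h8 h9 (by linarith)).trans ?_
    nlinarith
  have hreward := R.sum_expectedReward_le alg (fun t => σ (t / τ)) T
  rw [← hN] at hreward
  have hopt : ∀ t ∈ Finset.range T, 1 / 2 + R.ε / (5 * R.δ) ≤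
      optimalAverageReward ((R.mdp fun t => σ (t / τ)).trans t)
        ((R.mdp fun t => σ (t / τ)).meanReward t) := by
    intro t ht
    have htL : t / τ < T / τ + 1 :=
      Nat.lt_succ_of_le (Nat.div_le_div_right (Finset.mem_range.1 ht).le)
    obtain ⟨p, hp, hpl⟩ := h2 _ htL
    have hm : (R.mdp fun t => σ (t / τ)).meanReward t = fun s _ => R.rew s := by
      ext s a
      exact R.meanReward_mdp _ _ _ _
    have hk : (R.mdp fun t => σ (t / τ)).trans t = R.kernel (some (p.1, p.2)) := by
      simp only [mdp, hp]
    rw [hm, hk]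
    exact hB.le_optimalAverageReward hpl hε hδB
  have hsum := Finset.sum_le_sum hopt
  rw [Finset.sum_const, Finset.card_range, nsmul_eq_mul] at hsum
  rw [NonstationaryMDP.dynamicRegret, Finset.sum_sub_distrib]
  have hx : 0 ≤ R.ε / R.δ := by positivity
  have e1 : R.ε / (5 * R.δ) = R.ε / R.δ / 5 := by field_simp
  have e2 : R.ε / (2 * R.δ) = R.ε / R.δ / 2 := by field_simp
  rw [e1] at hsum
  rw [e2] at hreward
  have h10 := mul_le_mul_of_nonneg_left hNle (show 0 ≤ R.ε / R.δ / 2 by positivity)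
  have h11 : 0 ≤ T * (R.ε / R.δ) := by positivity
  linarith

theorem rpow_one_third_pow {x : ℝ} (hx : 0 ≤ x) : (x ^ (1 / 3 : ℝ)) ^ 3 = x := by
  rw [← Real.rpow_natCast, ← Real.rpow_mul hx]
  norm_num

theorem rpow_two_thirds {x : ℝ} (hx : 0 ≤ x) : x ^ (2 / 3 : ℝ) = (x ^ (1 / 3 : ℝ)) ^ 2 := by
  rw [← Real.rpow_natCast, ← Real.rpow_mul hx]
  norm_num

/-- Here `z = (S A Δ / (D T))^(1/3)` is the natural size of `ε`. Using the cube roots as variables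
makes every identity polynomial. -/
theorem exists_scale {S A Δ D T : ℝ} (hS0 : 0 < S) (hA0 : 0 < A) (hΔ : 0 < Δ) (hD0 : 0 < D)
    (hT0 : 0 < T) (hT' : S * A * Δ * D ^ 2 ≤ T) :
    ∃ z, 0 < z ∧ z ^ 3 * (D * T) = S * A * Δ ∧
      S ^ (1 / 3 : ℝ) * A ^ (1 / 3 : ℝ) * Δ ^ (1 / 3 : ℝ) * D ^ (2 / 3 : ℝ) * T ^ (2 / 3 : ℝ) =
        z * D * T ∧ z * D ≤ 1 := by
  rw [rpow_two_thirds hD0.le, rpow_two_thirds hT0.le]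
  have hs3 := rpow_one_third_pow hS0.le
  have ha3 := rpow_one_third_pow hA0.le
  have hv3 := rpow_one_third_pow hΔ.le
  have hd3 := rpow_one_third_pow hD0.le
  have ht3 := rpow_one_third_pow hT0.le
  have hs0 : 0 < S ^ (1 / 3 : ℝ) := Real.rpow_pos_of_pos hS0 _
  have ha0 : 0 < A ^ (1 / 3 : ℝ) := Real.rpow_pos_of_pos hA0 _
  have hv0 : 0 < Δ ^ (1 / 3 : ℝ) := Real.rpow_pos_of_pos hΔ _
  have hd0 : 0 < D ^ (1 / 3 : ℝ) := Real.rpow_pos_of_pos hD0 _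
  have ht0 : 0 < T ^ (1 / 3 : ℝ) := Real.rpow_pos_of_pos hT0 _
  set s := S ^ (1 / 3 : ℝ)
  set a := A ^ (1 / 3 : ℝ)
  set v := Δ ^ (1 / 3 : ℝ)
  set d := D ^ (1 / 3 : ℝ)
  set t := T ^ (1 / 3 : ℝ)
  obtain ⟨z, hz⟩ : ∃ z, z = s * a * v / (d * t) := ⟨_, rfl⟩
  have hz0 : 0 < z := by rw [hz]; positivity
  have hz3 : z ^ 3 * (D * T) = S * A * Δ := by
    rw [hz, ← hs3, ← ha3, ← hv3, ← hd3, ← ht3]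
    field_simp
  have hzT : s * a * v * d ^ 2 * t ^ 2 = z * D * T := by
    rw [hz, ← hd3, ← ht3]
    field_simp
  have hzD : z * D ≤ 1 := by
    have h1 : (z * D) ^ 3 ≤ 1 ^ 3 := by
      have : (z * D) ^ 3 * T ≤ 1 ^ 3 * T := by
        calc (z * D) ^ 3 * T = z ^ 3 * (D * T) * D ^ 2 := by ring
          _ = S * A * Δ * D ^ 2 := by rw [hz3]
          _ ≤ _ := by linarith
      exact le_of_mul_le_mul_right this hT0
    exact le_of_pow_le_pow_left₀ (by norm_num) zero_le_one h1
  exact ⟨z, hz0, hz3, hzT, hzD⟩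

theorem exists_hard_instance {S A T : ℕ} {Δ D : ℝ} (hS : 2 ≤ S) (hA : 2 ≤ A) (hΔ : 0 < Δ)
    (hD : 100 * (1 + Real.logb A S) ≤ D) (hT : (S : ℝ) * A * D ≤ T)
    (hT' : (S : ℝ) * A * Δ * D ^ 2 ≤ T) (alg : Algorithm (Fin S) (Fin A)) :
    ∃ M : NonstationaryMDP (Fin S) (Fin A),
      M.totalVariation T ≤ Δ ∧ M.maxDiameter T ≤ ENNReal.ofReal D ∧
      1 / 10000 * ((S : ℝ) ^ (1 / 3 : ℝ) * (A : ℝ) ^ (1 / 3 : ℝ) * Δ ^ (1 / 3 : ℝ) *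
        D ^ (2 / 3 : ℝ) * (T : ℝ) ^ (2 / 3 : ℝ)) ≤ M.dynamicRegret alg T := by
  have hSr : (2 : ℝ) ≤ S := by exact_mod_cast hS
  have hAr : (2 : ℝ) ≤ A := by exact_mod_cast hA
  have hlog0 : 0 ≤ Real.logb A S := Real.logb_nonneg (by linarith) (by linarith)
  have hD0 : 0 < D := by linarith
  have hSA : 4 ≤ (S : ℝ) * A :=
    (mul_le_mul hSr hAr zero_le_two (by linarith)).trans' (by norm_num)
  have hT40 : 4 * D ≤ T := le_trans (mul_le_mul_of_nonneg_right hSA hD0.le) hT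
  have hT0 : (0 : ℝ) < T := by linarith
  have hS0 : (0 : ℝ) < S := by linarith
  have hA0 : (0 : ℝ) < A := by linarith
  set B := Nat.log A S + 1 with hB
  have hBD : (B : ℝ) ≤ D / 100 := by
    have := Real.natLog_le_logb S A
    rw [hB]
    push_cast
    linarith
  obtain ⟨z, hz0, hz3, hzT, hzD⟩ := exists_scale hS0 hA0 hΔ hD0 hT0 hT'
  rw [hzT]
  -- The choices are `δ = 10/D` and `ε = z/10`; `z D ≤ 1` makes `ε ≤ δ/20`.
  have hδ : 0 < 10 / D := by positivity
  have hε : 0 < z / 10 := by positivity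
  have hεδ : z / 10 ≤ 10 / D / 20 := by
    rw [div_div, div_le_div_iff₀ (by norm_num) (by positivity)]
    linarith
  have hδ1 : 10 / D ≤ 1 / 10 := by
    rw [div_le_div_iff₀ hD0 (by norm_num)]
    linarith
  have hadd : 10 / D + z / 10 ≤ 1 / 2 := by linarith
  have : Nonempty (Fin A) := ⟨⟨0, by omega⟩⟩
  obtain ⟨R, hRδ, hRε, hcard, hnav⟩ : ∃ R : Arena (Fin S) (Fin A), R.δ = 10 / D ∧ R.ε = z / 10 ∧
      S ≤ 4 * R.leaf.card ∧ R.Navigable B :=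
    ⟨heapArena hS hδ hε hadd, rfl, rfl, heapArena_leaf_card hS hδ hε hadd hA,
      heapArena_navigable hS hδ hε hadd hA⟩
  obtain ⟨n, hn⟩ : ∃ n : ℝ, n = R.leaf.card * A := ⟨_, rfl⟩
  have hc1 : (1 : ℝ) ≤ R.leaf.card := by
    exact_mod_cast (show 1 ≤ R.leaf.card by omega)
  have hn2 : 2 ≤ n := by
    rw [hn]
    exact (mul_le_mul hc1 hAr zero_le_two (by linarith)).trans' (by norm_num)
  have hnSA : S * A ≤ 4 * n := by
    have : (S : ℝ) ≤ 4 * R.leaf.card := by exact_mod_cast hcard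
    have := mul_le_mul_of_nonneg_right this hA0.le
    rw [hn]
    linarith
  -- `Q` is the block length at which `ε² Q / δ = n / 200` exactly.
  obtain ⟨Q, hQ⟩ : ∃ Q : ℝ, Q = 5 * n / (D * z ^ 2) := ⟨_, rfl⟩
  have hQD : 10 * D ≤ Q := by
    rw [hQ, le_div_iff₀ (by positivity)]
    have : (z * D) ^ 2 ≤ 1 := pow_le_one₀ (by positivity) hzD
    have e : 10 * D * (D * z ^ 2) = 10 * (z * D) ^ 2 := by ring
    rw [e]
    linarith
  have hQ1 : Q - 1 < ⌊Q⌋₊ := by linarith [Nat.lt_floor_add_one Q]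
  have hQ0 : (⌊Q⌋₊ : ℝ) ≤ Q := Nat.floor_le (by linarith)
  set τ := min T ⌊Q⌋₊ with hτ
  have hτQ : (τ : ℝ) ≤ Q := le_trans (by exact_mod_cast min_le_right _ _) hQ0
  have hτD : 4 * D ≤ τ := by
    rw [hτ, Nat.cast_min]
    exact le_min hT40 (by linarith)
  obtain ⟨σ, hσ⟩ := R.exists_regret_ge hnav (by rw [hRδ, hRε]; exact hεδ)
    (by
      rw [hRδ, div_mul_eq_mul_div, div_le_div_iff₀ hD0 (by norm_num)]
      linarith) (n := n) (by rw [hn, Fintype.card_fin]) hn2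
    (min_le_left T ⌊Q⌋₊)
    (by
      rw [hRδ, mul_div_assoc', le_div_iff₀ hD0]
      linarith)
    (by
      rw [hRδ, hRε, ← hτ]
      have : (z / 10) ^ 2 * τ ≤ (z / 10) ^ 2 * Q := mul_le_mul_of_nonneg_left hτQ (by positivity)
      have e : (z / 10) ^ 2 * Q = n / 200 * (10 / D) := by
        rw [hQ]
        field_simp
        norm_num
      rw [div_le_iff₀ hδ]
      linarith) alg
  rw [← hτ] at hσ
  refine ⟨R.mdp fun t => σ (t / τ), ?_, ?_, ?_⟩
  · refine (R.totalVariation_mdp_le σ τ T).trans ?_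
    -- If `T ≤ ⌊Q⌋₊`, a single block covers the horizon and the variation is zero, however small `Δ`
    -- is.
    rcases le_or_gt T ⌊Q⌋₊ with hTQ | hTQ
    · rw [hτ, min_eq_left hTQ, Nat.div_eq_of_lt]
      · simpa using hΔ.le
      · have : 0 < T := by exact_mod_cast hT0
        omega
    · have hτe : τ = ⌊Q⌋₊ := min_eq_right hTQ.le
      have hQpos : 0 < Q := by linarith
      have h1 : Q / 2 ≤ τ := by rw [hτe]; linarith
      have h2 : (((T - 1) / τ : ℕ) : ℝ) ≤ T / (Q / 2) := by
        calc (((T - 1) / τ : ℕ) : ℝ) ≤ ((T / τ : ℕ) : ℝ) := by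
              exact_mod_cast Nat.div_le_div_right (Nat.sub_le _ _)
          _ ≤ T / τ := Nat.cast_div_le
          _ ≤ _ := div_le_div_of_nonneg_left hT0.le (by linarith) h1
      calc 2 * R.ε * (((T - 1) / τ : ℕ) : ℝ) ≤ 2 * R.ε * (T / (Q / 2)) :=
            mul_le_mul_of_nonneg_left h2 (by rw [hRε]; positivity)
        _ = 2 / 25 * (z ^ 3 * (D * T)) / n := by
            rw [hRε, hQ]
            field_simp
            norm_num
        _ ≤ Δ := by
            rw [hz3, div_le_iff₀ (by linarith)]
            have h3 := mul_le_mul_of_nonneg_right hnSA hΔ.le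
            have h4 : 0 ≤ Δ * n := mul_nonneg hΔ.le (by linarith)
            linarith
  · refine iSup₂_le fun i _ => (hnav.diameter_le _).trans (ENNReal.ofReal_le_ofReal ?_)
    rw [hRδ]
    have : 2 / (10 / D) = D / 5 := by field_simp; norm_num
    linarith
  · refine le_trans (le_of_eq ?_) hσ
    rw [hRδ, hRε]
    field_simp
    norm_num

end

end UndiscountedRL

theorem mainTheorem6 :
    ∃ c : ℝ, 0 < c ∧ ∃ C : ℝ, 0 < C ∧
      ∀ (S A T : ℕ) (Δ D : ℝ), 2 ≤ S → 2 ≤ A → 0 < Δ →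
        C * (1 + Real.logb A S) ≤ D →
        (S : ℝ) * A * D ≤ T →
        (S : ℝ) * A * Δ * D ^ 2 ≤ T →
        ∀ alg : UndiscountedRL.Algorithm (Fin S) (Fin A),
          ∃ M : UndiscountedRL.NonstationaryMDP (Fin S) (Fin A),
            M.totalVariation T ≤ Δ ∧
            M.maxDiameter T ≤ ENNReal.ofReal D ∧
            c * ((S : ℝ) ^ (1 / 3 : ℝ) * (A : ℝ) ^ (1 / 3 : ℝ) * Δ ^ (1 / 3 : ℝ) *
                D ^ (2 / 3 : ℝ) * (T : ℝ) ^ (2 / 3 : ℝ)) ≤ M.dynamicRegret alg T := by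
  exact ⟨1 / 10000, by norm_num, 100, by norm_num, fun S A T Δ D hS hA hΔ hD hT hT' alg =>
    UndiscountedRL.exists_hard_instance hS hA hΔ hD hT hT' alg⟩
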